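/- Let $K$ be a field, let $X=\{x_1,x_2,\ldots\}$ be a finite or countable totally ordered alphabet ($x_1<x_2<\cdots$), let $t\notin X$ and $\bar X=X\cup\{t\}$. Put $F=K\langle X\rangle$, $\bar F=K\langle\bar X\rangle$ (free associative algebras), and $P=K[X\times\mathbb N^*]$, $\bar P=K[\bar X\times\mathbb N^*]$ (commutative polynomial algebras, with variables written $a(j)$, $j\ge1$), where $i\in\mathbb N$ acts by $i\cdot a(j)=a(i+j)$. A monomial of $\bar P$ has multidegree $(\mu_k)_k$, where $\mu_k$ is its number of variables at place $k$ (with multiplicity). Let $1^d$ be the multidegree with $\mu_k=1$ for $k\le d$ and $\mu_k=0$ for $k>d$, and let $\bar L\subset\bar P$ be the set of multilinear elements, i.e. of those that are multihomogeneous of multidegree $1^d$ for some $d\ge0$. *Maps.* $\bar\iota:\bar F\to\bar P$ is the $K$-linear embedding $a_1a_2\cdots a_d\mapsto a_1(1)a_2(2)\cdots a_d(d)$; $\varphi:\bar F\to F$ and $\psi:\bar P\to P$ are the algebra maps that fix the letters $x_i$, resp. the variables $x_i(j)$, and send $t$, resp. all $t(j)$, to $1$. For $0\ne f\in F$ with homogeneous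 components $f_k$ and top degree $d$ put $f^*=\sum_kf_kt^{d-k}\in\bar F$. For $0\neq f\in P$ with multihomogeneous components $f_\mu$ and $\nu_k=\max_\mu\mu_k$ put $f^*=\sum_\mu f_\mu\prod_kt(k)^{\nu_k-\mu_k}\in\bar P$. *Orderings.* Fix a monomial ordering of $K[a(1)\mid a\in\bar X]$ with $t(1)\prec x_1(1)\prec x_2(1)\prec\cdots$. Order the monomials of $\bar P$ by the induced place ordering: two distinct monomials are compared at the largest place $j$ where their factors in the variables $a(j)$, $a\in\bar X$, differ, by comparing these two factors in the fixed ordering (after identifying $a(j)$ with $a(1)$). Order the words over $X$ by $u\prec v\iff\bar\iota(u)\prec\bar\iota(v)$ (the graded right lexicographic ordering). A set $G\subset I$ is a Gröbner basis of a two-sided ideal $I\subset F$ if for every $0\ne f\in I$ there are $0\ne g\in G$ and words $u,v$ with $\mathrm{lm}(f)=u\,\mathrm{lm}(g)\,v$. For $f,g\in\bar P\setminus\{0\}$ with $l=\mathrm{lcm}(\mathrm{lm}(f),\mathrm{lm}(g))$ put $\mathrm{spoly}(f,g)=\frac{l}{\mathrm{lt}(f)}f-\frac{l}{\mathrm{lt}(g)}g$.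 $\mathrm{Reduce}(p,S)$ denotes any normal form of $p$ modulo $S$, obtained by finitely many steps, each of which cancels a monomial divisible by some $\mathrm{lm}(g)$, $0\ne g\in S$; in a normal form no monomial is divisible by such an $\mathrm{lm}(g)$. *Algorithm FreeGBasis.* Input: a set $H\subset F$ generating the two-sided ideal $I$. Start with $G=\bar\iota\big(\{f^*\mid f\in H,\,f\ne0\}\cup\{[t,x]\mid x\in X\}\big)$ and $B=G\times G$. While $B\ne\emptyset$: choose $(f,g)\in B$, remove it from $B$, and for all $i\ge0$ (in any order) with $\gcd(\mathrm{lm}(f),\mathrm{lm}(i\cdot g))\ne1$ and $\mathrm{lcm}(\mathrm{lm}(f),\mathrm{lm}(i\cdot g))\in\bar L$ compute $h=\mathrm{Reduce}(\mathrm{spoly}(f,i\cdot g),\mathbb N\cdot G)$ with the current $G$; if $h\ne0$, replace $h$ by $\psi(h)^*$, then add $(h,h)$ and all $(h,k),(k,h)$, $k\in G$, to $B$, and then add $h$ to $G$. When $B=\emptyset$, return $\varphi(\bar\iota^{-1}(G))$. **Proposition.** The algorithm FreeGBasis is correct: for every two-sided ideal $I\subset F$ (not necessarily graded) and every generating set $H$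 of $I$, whenever the algorithm, run on $H$ with any choices of pairs, of the order of the shifts $i$ and of reductions, terminates after finitely many passages through the while loop, the returned set $\varphi(\bar\iota^{-1}(G))$ is a Gröbner basis of $I$. -/

import Mathlib

/-! ### Free associative algebras, letterplace algebras and the maps between them -/

namespace Letterplace

open MvPolynomial

/-- The free associative algebra `K⟨A⟩` on the alphabet `A`: finite `K`-linear combinations of
words, multiplied by concatenation. -/
abbrev FreeAssoc (K A : Type*) [Field K] := MonoidAlgebra K (FreeMonoid A)

/-- The letterplace algebra `K[A × ℕ*]` on the alphabet `A`. Places are numbered from `0` here: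
the variable `X (a, j)` is `a(j + 1)`. -/
abbrev LPAlg (K A : Type*) [Field K] := MvPolynomial (A × ℕ) K

/-- The extended alphabet `X ∪ {t}`, where `t` is `none`. -/
abbrev Ext (X : Type*) := Option X

/-- The extra letter `t`, as an element of `K⟨X ∪ {t}⟩`. -/
noncomputable def tVar (K X : Type*) [Field K] : FreeAssoc K (Ext X) :=
  MonoidAlgebra.of K _ (FreeMonoid.of none)

/-- The letter `x`, as an element of `K⟨X ∪ {t}⟩`. -/
noncomputable def xVar (K : Type*) {X : Type*} [Field K] (x : X) : FreeAssoc K (Ext X) :=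
  MonoidAlgebra.of K _ (FreeMonoid.of (some x))

/-- The algebra map `φ : K⟨X ∪ {t}⟩ → K⟨X⟩` with `x ↦ x` and `t ↦ 1`. -/
noncomputable def dehom (K X : Type*) [Field K] : FreeAssoc K (Ext X) →ₐ[K] FreeAssoc K X :=
  MonoidAlgebra.lift K _ _ (FreeMonoid.lift fun a : Ext X =>
    a.elim 1 fun x => MonoidAlgebra.of K _ (FreeMonoid.of x))

/-- The top degree of an element of the free associative algebra. -/
noncomputable def topDegree {K X : Type*} [Field K] (f : FreeAssoc K X) : ℕ :=
  f.coeff.support.sup FreeMonoid.length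

/-- The homogenization `f^* = ∑ₖ fₖ t ^ (d - k)`, `d` the top degree of `f`, written as a sum over
the words of `f`. -/
noncomputable def homogenize {K X : Type*} [Field K] (f : FreeAssoc K X) : FreeAssoc K (Ext X) :=
  ∑ w ∈ f.coeff.support,
    MonoidAlgebra.single
      (FreeMonoid.map some w * FreeMonoid.of none ^ (topDegree f - w.length)) (f.coeff w)

/-- The exponent vector of the monomial `a₁(1) a₂(2) ⋯ a_d(d)` attached to the word
`a₁ a₂ ⋯ a_d`. -/
noncomputable def wordMon {A : Type*} (w : FreeMonoid A) : (A × ℕ) →₀ ℕ :=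
  (w.toList.zipIdx.map fun p => Finsupp.single p 1).sum

/-- The `K`-linear letterplace embedding `a₁ a₂ ⋯ a_d ↦ a₁(1) a₂(2) ⋯ a_d(d)`. -/
noncomputable def embed (K A : Type*) [Field K] : FreeAssoc K A →ₗ[K] LPAlg K A where
  toFun f := ∑ w ∈ f.coeff.support, monomial (wordMon w) (f.coeff w)
  map_add' f g := by
    classical
    have := Finsupp.sum_add_index' (f := f.coeff) (g := g.coeff)
      (h := fun w c => (monomial (wordMon w) c : LPAlg K A)) (by simp) (by simp)
    simpa [Finsupp.sum] using this
  map_smul' c f := by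
    have := Finsupp.sum_smul_index' (g := f.coeff) (b := c)
      (h := fun w c => (monomial (wordMon w) c : LPAlg K A)) (by simp)
    simpa [Finsupp.sum, Finset.smul_sum, smul_monomial] using this

/-- The action of `i : ℕ` on the letterplace algebra: `i · a(j) = a(i + j)`. -/
noncomputable def shift {K A : Type*} [Field K] (i : ℕ) : LPAlg K A →ₐ[K] LPAlg K A :=
  rename fun v => (v.1, i + v.2)

/-- The orbit `ℕ · G`. -/
def shifts {K A : Type*} [Field K] (G : Set (LPAlg K A)) : Set (LPAlg K A) :=
  {p | ∃ i : ℕ, ∃ g ∈ G, p = shift i g}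

/-- The multidegree of a monomial: the `k`-th entry counts, with multiplicity, the variables at
place `k`. -/
noncomputable def multideg {A : Type*} (m : (A × ℕ) →₀ ℕ) : ℕ →₀ ℕ :=
  m.mapDomain Prod.snd

/-- The multidegree `1^d`, equal to `1` at the first `d` places and `0` elsewhere. -/
noncomputable def oneDeg (d : ℕ) : ℕ →₀ ℕ :=
  ∑ k ∈ Finset.range d, Finsupp.single k 1

/-- The set of multilinear elements: those that are multihomogeneous of multidegree `1^d` for
some `d`. -/
def multilinear (K A : Type*) [Field K] : Set (LPAlg K A) :=
  {p | ∃ d, ∀ m ∈ p.support, multideg m = oneDeg d}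

/-- The algebra map `ψ` between letterplace algebras with `x(j) ↦ x(j)` and `t(j) ↦ 1`. -/
noncomputable def lpDehom (K X : Type*) [Field K] : LPAlg K (Ext X) →ₐ[K] LPAlg K X :=
  aeval fun v : Ext X × ℕ => v.1.elim 1 fun x => MvPolynomial.X (x, v.2)

/-- The top multidegree: the placewise maximum of the multidegrees of the monomials of `f`. -/
noncomputable def topMultideg {K X : Type*} [Field K] (f : LPAlg K X) : ℕ →₀ ℕ :=
  f.support.sup multideg

/-- The multihomogenization `f^* = ∑_μ f_μ ∏ₖ t(k) ^ (νₖ - μₖ)`, `ν` the top multidegree of `f`,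
written as a sum over the monomials of `f`. -/
noncomputable def lpHomogenize {K X : Type*} [Field K] (f : LPAlg K X) : LPAlg K (Ext X) :=
  ∑ m ∈ f.support,
    monomial (m.mapDomain (fun v => ((some v.1 : Ext X), v.2)) +
      (topMultideg f - multideg m).mapDomain (fun k => ((none : Ext X), k))) (f.coeff m)

/-! ### Monomial orderings -/

/-- The family `j ↦ m(j)` of the factors of the monomial `m` at the several places. -/
noncomputable def factors (A : Type*) : ((A × ℕ) →₀ ℕ) ≃+ (ℕ →₀ (A →₀ ℕ)) :=
  (Finsupp.domCongr (Equiv.prodComm A ℕ)).trans Finsupp.curryAddEquiv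

/-- The place `ℕ`-ordering induced by a monomial ordering `ord` of the first place: two distinct
monomials are compared at the largest place where their factors differ, by means of `ord`. -/
noncomputable def placeOrder {A : Type*} (ord : MonomialOrder A) : MonomialOrder (A × ℕ) :=
  haveI : IsBotZeroClass ord.syn := ⟨fun a => ord.zero_le a⟩
  { syn := Colex (ℕ →₀ ord.syn)
    toSyn := (factors A).trans ((Finsupp.mapRange.addEquiv ord.toSyn).trans
      { toColex with map_add' := fun _ _ => rfl })
    toSyn_monotone := by
      intro m n h
      apply Finsupp.toColex_monotone
      intro j
      apply ord.toSyn_monotone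
      intro a
      exact h (a, j) }

/-- The ordering of the words over `X ∪ {t}` induced, through the letterplace embedding, by the
place ordering; for words over `X` it is the restriction of that ordering. -/
def wordLT {X : Type*} (ord : MonomialOrder (Ext X)) (u v : FreeMonoid X) : Prop :=
  (placeOrder ord).toSyn (wordMon (FreeMonoid.map some u)) <
    (placeOrder ord).toSyn (wordMon (FreeMonoid.map some v))

/-- `w` is the leading monomial of `f`, the greatest word that occurs in `f`. -/
def IsLeadingWord {K X : Type*} [Field K] (ord : MonomialOrder (Ext X)) (f : FreeAssoc K X)
    (w : FreeMonoid X) : Prop :=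
  w ∈ f.coeff.support ∧ ∀ v ∈ f.coeff.support, v ≠ w → wordLT ord v w

/-- `G` is a Gröbner basis of the two-sided ideal `I`. -/
def IsGroebnerBasis {K X : Type*} [Field K] (ord : MonomialOrder (Ext X))
    (G : Set (FreeAssoc K X)) (I : TwoSidedIdeal (FreeAssoc K X)) : Prop :=
  (∀ g ∈ G, g ∈ I) ∧
    ∀ f ∈ I, f ≠ 0 → ∃ w, IsLeadingWord ord f w ∧
      ∃ g ∈ G, g ≠ 0 ∧ ∃ w', IsLeadingWord ord g w' ∧ ∃ u v, w = u * w' * v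

/-! ### S-polynomials and reduction -/

/-- `spoly(f, g) = (l / lt f) f - (l / lt g) g`, with `l` the lcm of the leading monomials. -/
noncomputable def spoly {K A : Type*} [Field K] (ord : MonomialOrder A) (f g : MvPolynomial A K) :
    MvPolynomial A K :=
  monomial (ord.degree f ⊔ ord.degree g - ord.degree f) (ord.leadingCoeff f)⁻¹ * f -
    monomial (ord.degree f ⊔ ord.degree g - ord.degree g) (ord.leadingCoeff g)⁻¹ * g

/-- One step of reduction of `p` by `S`: a monomial of `p` that is divisible by the leading
monomial of some `g ∈ S` is cancelled by means of `g`. -/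
def ReduceStep {K A : Type*} [Field K] (ord : MonomialOrder A) (S : Set (MvPolynomial A K))
    (p q : MvPolynomial A K) : Prop :=
  ∃ g ∈ S, g ≠ 0 ∧ ∃ u : A →₀ ℕ, u + ord.degree g ∈ p.support ∧
    q = p - monomial u (p.coeff (u + ord.degree g) / ord.leadingCoeff g) * g

/-- `p` is in normal form modulo `S`: no monomial of `p` is divisible by the leading monomial of
a nonzero element of `S`. -/
def IsNormal {K A : Type*} [Field K] (ord : MonomialOrder A) (S : Set (MvPolynomial A K))
    (p : MvPolynomial A K) : Prop :=
  ∀ m ∈ p.support, ∀ g ∈ S, g ≠ 0 → ¬ ord.degree g ≤ m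

/-- `h` is a possible value of `Reduce(p, S)`: a normal form modulo `S` that is reached from `p`
by finitely many reduction steps. -/
def IsReduct {K A : Type*} [Field K] (ord : MonomialOrder A) (S : Set (MvPolynomial A K))
    (p h : MvPolynomial A K) : Prop :=
  Relation.ReflTransGen (ReduceStep ord S) p h ∧ IsNormal ord S h

/-! ### The algorithm -/

/-- The variables of the algorithm: the current basis `G` and the current set `B` of pairs. -/
structure State (K X : Type*) [Field K] where
  G : Set (LPAlg K (Ext X))
  B : Set (LPAlg K (Ext X) × LPAlg K (Ext X))

/-- The initial state: `G` consists of the images of the homogenizations of the nonzero elements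
of `H` and of the commutators `[t, x]`, and `B` of all pairs of elements of `G`. -/
def initial {K X : Type*} [Field K] (H : Set (FreeAssoc K X)) : State K X :=
  let G := embed K (Ext X) ''
    ({p | ∃ f ∈ H, f ≠ 0 ∧ p = homogenize f} ∪
      {p | ∃ x : X, p = tVar K X * xVar K x - xVar K x * tVar K X})
  { G := G, B := G ×ˢ G }

/-- The condition on the shift `i` in the inner loop for the pair `(f, g)`: the leading monomials
of `f` and `i · g` are not coprime and their lcm is multilinear. -/
def Admissible {K X : Type*} [Field K] (ord : MonomialOrder (Ext X))
    (f g : LPAlg K (Ext X)) (i : ℕ) : Prop :=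
  (placeOrder ord).degree f ⊓ (placeOrder ord).degree (shift i g) ≠ 0 ∧
    monomial ((placeOrder ord).degree f ⊔ (placeOrder ord).degree (shift i g)) (1 : K) ∈
      multilinear K (Ext X)

/-- The effect of a value `h` of `Reduce` on the state. A nonzero `h` is replaced by `ψ(h)^*`, the
new pairs are put into `B`, and the new element is put into `G`. -/
inductive Update {K X : Type*} [Field K] (s : State K X) : LPAlg K (Ext X) → State K X → Prop
  | zero : Update s 0 s
  | new (h h' : LPAlg K (Ext X)) (hne : h ≠ 0) (hh' : h' = lpHomogenize (lpDehom K X h)) :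
      Update s h
        { G := s.G ∪ {h'}
          B := s.B ∪ ({(h', h')} ∪ {p | ∃ k ∈ s.G, p = (h', k) ∨ p = (k, h')}) }

/-- The execution of the inner loop for the pair `(f, g)` through a given list of shifts. Each
reduction is modulo the orbit of the basis that is current at that moment. -/
inductive InnerLoop {K X : Type*} [Field K] (ord : MonomialOrder (Ext X))
    (f g : LPAlg K (Ext X)) : List ℕ → State K X → State K X → Prop
  | nil (s : State K X) : InnerLoop ord f g [] s s
  | cons (i : ℕ) (l : List ℕ) (s s' s'' : State K X) (h : LPAlg K (Ext X))
      (hred : IsReduct (placeOrder ord) (shifts s.G) (spoly (placeOrder ord) f (shift i g)) h)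
      (hupd : Update s h s') (hrest : InnerLoop ord f g l s' s'') :
      InnerLoop ord f g (i :: l) s s''

/-- One passage through the while loop: a pair is chosen in `B` and removed from it, and the inner
loop is executed for all the admissible shifts, in some order. -/
def Step {K X : Type*} [Field K] (ord : MonomialOrder (Ext X)) (s s' : State K X) : Prop :=
  ∃ f g, (f, g) ∈ s.B ∧ ∃ l : List ℕ, l.Nodup ∧ (∀ i, i ∈ l ↔ Admissible ord f g i) ∧
    InnerLoop ord f g l { G := s.G, B := s.B \ {(f, g)} } s'

/-- The algorithm FreeGBasis, on the input `H`, can terminate with the output `R`: finitely many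
passages through the while loop lead to a state with `B = ∅`, and `R` is the set of the elements
`φ(p)` with the image of `p` in the final `G`. -/
def FreeGBasisReturns {K X : Type*} [Field K] (ord : MonomialOrder (Ext X))
    (H R : Set (FreeAssoc K X)) : Prop :=
  ∃ s : State K X, Relation.ReflTransGen (Step ord) (initial H) s ∧ s.B = ∅ ∧
    R = dehom K X '' (embed K (Ext X) ⁻¹' s.G)

end Letterplace

/-! The proof is Buchberger's criterion in the free associative algebra over `X`, applied to the set
`dehomSet G` of all nonzero `p` with the image of `p^*` in the final `G`. By
`OverlapsResolve.exists_isLead` it suffices that for every overlap `W` of leading words of two such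
polynomials the S-polynomial is a combination of multiples whose leading words are smaller than `W`.

Such representations are read off from the algorithm. On homogeneous elements the letterplace
operations are operations on words: divisibility by a shifted monomial is occurrence as a factor, a
multilinear lcm is an overlap (`wordMon_sup_shiftMon`), and S-polynomials and reduction steps are
images of combinations of multiples `a g b` (`spoly_embed`, `ReduceStep.exists_eq_embed`). Since `t`
is the smallest letter and words of equal length are compared from the right, `p^*` and `p` have the
same leading word (`IsLead.homogenize`). So the algorithm expresses the S-polynomial of `p^*` and
`q^*` by multiples whose leading words have the length of `W` and are smaller than `W`. Now set `t =
1`. The commutators vanish, and the bounds survive because `W` contains no `t`: a word that loses a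
letter becomes shorter than `W`, hence smaller (`extKey_eraseT_lt`).

The replacement of a normal form `h` by `ψ(h)^*` is harmless. The commutators have leading words `t
x`, so in a normal form every `t` stands at the end of its word. Hence `h` is the image of some `q`
for which `ψ(h)^*` is the image of `φ(q)^*`, and `q` is `φ(q)^*` times a power of `t`
(`IsAdapted.update`).

A loop invariant records that each pair is either waiting in `B` or has all its admissible shifts
resolved; when `B` is empty every overlap is resolved. -/

namespace Letterplace

open MvPolynomial

/-! ### The Gröbner basis criterion in the free associative algebra -/

/-- The word `w`, as an element of the free associative algebra. -/
noncomputable def mon (K : Type*) {A : Type*} [Field K] (w : FreeMonoid A) : FreeAssoc K A :=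
  MonoidAlgebra.single w 1

/-- `w` is the leading word of `f` with respect to the ordering of the words by `key`. -/
def IsLead {K A S : Type*} [Field K] [LinearOrder S] (key : FreeMonoid A → S) (f : FreeAssoc K A)
    (w : FreeMonoid A) : Prop :=
  w ∈ f.coeff.support ∧ ∀ v ∈ f.coeff.support, v ≠ w → key v < key w

/-- The span of the multiples `a g b` with `g ∈ G` whose leading word satisfies `P`. -/
noncomputable def below {K A S : Type*} [Field K] [LinearOrder S] (key : FreeMonoid A → S)
    (G : Set (FreeAssoc K A)) (P : FreeMonoid A → Prop) : Submodule K (FreeAssoc K A) :=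
  Submodule.span K {x | ∃ g ∈ G, ∃ w a b, IsLead key g w ∧ P (a * w * b) ∧
    x = mon K a * g * mon K b}

section Words

variable {K A S : Type*} [Field K] [LinearOrder S] {key : FreeMonoid A → S}

theorem sum_smul_mon (f : FreeAssoc K A) : ∑ v ∈ f.coeff.support, f.coeff v • mon K v = f := by
  conv_rhs => rw [← f.sum_coeff_single]
  simp [Finsupp.sum, mon]

theorem mon_mul_mon (u v : FreeMonoid A) : mon K u * mon K v = mon K (u * v) :=
  (map_mul (MonoidAlgebra.of K (FreeMonoid A)) u v).symm

@[simp]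
theorem mon_one : mon K (1 : FreeMonoid A) = 1 := map_one (MonoidAlgebra.of K (FreeMonoid A))

theorem coeff_mon_mul_mul_mon (a b : FreeMonoid A) (f : FreeAssoc K A) (w : FreeMonoid A) :
    (mon K a * f * mon K b).coeff (a * w * b) = f.coeff w := by
  simp [mon]

theorem mem_support_mon_mul_mul_mon {a b : FreeMonoid A} {f : FreeAssoc K A} {w : FreeMonoid A}
    (h : w ∈ (mon K a * f * mon K b).coeff.support) : ∃ v ∈ f.coeff.support, w = a * v * b := by
  rw [Finsupp.mem_support_iff] at h
  by_contra! hne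
  apply h
  rw [← sum_smul_mon f, Finset.mul_sum, Finset.sum_mul, MonoidAlgebra.coeff_sum,
    Finsupp.finsetSum_apply]
  refine Finset.sum_eq_zero fun v hv => ?_
  rw [mul_smul_comm, smul_mul_assoc, mon_mul_mon, mon_mul_mon]
  simp [mon, (hne v hv).symm]

/-- Levi's lemma: of two prefixes of one word the shorter is a prefix of the longer. -/
theorem eq_mul_of_mul_eq_mul {a c x y : FreeMonoid A} (h : a * x = c * y)
    (hl : a.length ≤ c.length) : ∃ e, c = a * e ∧ x = e * y := by
  obtain ⟨e, he⟩ := List.prefix_of_prefix_length_le (l₁ := a.toList) (l₂ := c.toList)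
    (l₃ := (a * x).toList) ⟨x.toList, rfl⟩ (by rw [h]; exact ⟨y.toList, rfl⟩) hl
  have he' : c = a * FreeMonoid.ofList e := he.symm
  subst he'
  exact ⟨_, rfl, by rw [mul_assoc] at h; exact mul_left_cancel h⟩

theorem exists_isLead (hinj : Function.Injective key) {f : FreeAssoc K A} (hf : f ≠ 0) :
    ∃ w, IsLead key f w := by
  obtain ⟨w, hw, h⟩ := f.coeff.support.exists_max_image key
    (by simpa [Finset.nonempty_iff_ne_empty] using hf)
  exact ⟨w, hw, fun v hv hne => lt_of_le_of_ne (h v hv) fun e => hne (hinj e)⟩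

theorem IsLead.coeff_ne_zero {f : FreeAssoc K A} {w : FreeMonoid A} (h : IsLead key f w) :
    f.coeff w ≠ 0 := by simpa using h.1

theorem IsLead.unique {f : FreeAssoc K A} {w w' : FreeMonoid A} (h : IsLead key f w)
    (h' : IsLead key f w') : w = w' := by
  by_contra hne
  exact lt_asymm (h.2 w' h'.1 (Ne.symm hne)) (h'.2 w h.1 hne)

theorem IsLead.mul (hmul : ∀ a u v b, key u < key v → key (a * u * b) < key (a * v * b))
    {f : FreeAssoc K A} {w : FreeMonoid A} (h : IsLead key f w) (a b : FreeMonoid A) :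
    IsLead key (mon K a * f * mon K b) (a * w * b) := by
  refine ⟨by simpa [coeff_mon_mul_mul_mon] using h.1, fun v hv hne => ?_⟩
  obtain ⟨u, hu, rfl⟩ := mem_support_mon_mul_mul_mon hv
  exact hmul _ _ _ _ (h.2 u hu fun e => hne (by rw [e]))

variable {G : Set (FreeAssoc K A)} {P Q : FreeMonoid A → Prop}

theorem mul_mem_below {g : FreeAssoc K A} {w : FreeMonoid A} (hg : g ∈ G) (hw : IsLead key g w)
    {a b : FreeMonoid A} (h : P (a * w * b)) : mon K a * g * mon K b ∈ below key G P :=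
  Submodule.subset_span ⟨g, hg, w, a, b, hw, h, rfl⟩

theorem below_mono {G' : Set (FreeAssoc K A)} (hG : G ⊆ G') (h : ∀ w, P w → Q w) :
    below key G P ≤ below key G' Q := by
  apply Submodule.span_mono
  rintro x ⟨g, hg, w, a, b, hw, hP, rfl⟩
  exact ⟨g, hG hg, w, a, b, hw, h _ hP, rfl⟩

theorem mon_mul_mem_below (a b : FreeMonoid A) {f : FreeAssoc K A} (hf : f ∈ below key G P)
    (h : ∀ w, P w → Q (a * w * b)) : mon K a * f * mon K b ∈ below key G Q := by
  induction hf using Submodule.span_induction with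
  | mem x hx =>
    obtain ⟨g, hg, w, c, d, hw, hP, rfl⟩ := hx
    have := mul_mem_below (K := K) (P := Q) (a := a * c) (b := d * b) hg hw
      (by simpa [mul_assoc] using h _ hP)
    simpa [mul_assoc, ← mon_mul_mon] using this
  | zero => simp
  | add x y _ _ hx hy => rw [mul_add, add_mul]; exact add_mem hx hy
  | smul c x _ hx =>
    rw [mul_smul_comm, smul_mul_assoc]; exact Submodule.smul_mem _ _ hx

theorem lead_mul_mem_below {g f : FreeAssoc K A} {w a b : FreeMonoid A} (hg : g ∈ G)
    (hw : IsLead key g w) (h : ∀ v ∈ f.coeff.support, P (a * w * (v * b))) :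
    mon K a * g * (f * mon K b) ∈ below key G P := by
  rw [← sum_smul_mon f, Finset.sum_mul, Finset.mul_sum]
  refine sum_mem fun v hv => ?_
  rw [smul_mul_assoc, mul_smul_comm, mon_mul_mon]
  exact Submodule.smul_mem _ _ (mul_mem_below hg hw (h v hv))

theorem mul_lead_mem_below {g f : FreeAssoc K A} {w a b : FreeMonoid A} (hg : g ∈ G)
    (hw : IsLead key g w) (h : ∀ v ∈ f.coeff.support, P (a * v * w * b)) :
    mon K a * f * g * mon K b ∈ below key G P := by
  rw [← sum_smul_mon f, Finset.mul_sum, Finset.sum_mul, Finset.sum_mul]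
  refine sum_mem fun v hv => ?_
  rw [mul_smul_comm, smul_mul_assoc, smul_mul_assoc, mon_mul_mon]
  exact Submodule.smul_mem _ _ (mul_mem_below hg hw (h v hv))

/-- The lower terms of a polynomial, after normalization of the leading coefficient. -/
theorem IsLead.lt_of_mem_support {f : FreeAssoc K A} {w v : FreeMonoid A} (h : IsLead key f w)
    (hv : v ∈ ((f.coeff w)⁻¹ • f - mon K w).coeff.support) : key v < key w := by
  have hc := h.coeff_ne_zero
  by_cases e : v = w
  · subst e
    simp [mon, hc] at hv
  · refine h.2 v ?_ e
    simp only [Finsupp.mem_support_iff] at hv ⊢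
    intro h0
    apply hv
    simp [mon, h0, Ne.symm e]

/-! ### Buchberger's criterion from overlaps. -/

/-- All overlaps of the leading words of elements of `G` have S-polynomials in the span of the
multiples of elements of `G` with leading words smaller than the overlap. -/
def OverlapsResolve (key : FreeMonoid A → S) (G : Set (FreeAssoc K A)) : Prop :=
  ∀ p ∈ G, ∀ q ∈ G, ∀ u v, IsLead key p u → IsLead key q v → ∀ e r d, u * r = e * v * d →
    (r = 1 ∨ d = 1) → e.length < u.length → v ≠ 1 →
    (p.coeff u)⁻¹ • (p * mon K r) - (q.coeff v)⁻¹ • (mon K e * q * mon K d) ∈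
      below key G fun w => key w < key (u * r)

/-- The relative position of the two occurrences decides. If `u` ends before `v` starts, the
noncommutative product criterion applies. If `v` is empty, `q` is a constant. Otherwise `v` lies
inside `u` or sticks out on the right, and the hypothesis on overlaps is multiplied by the outer
words. -/
theorem OverlapsResolve.sub_mem_of_le (hS : OverlapsResolve key G)
    (hinj : Function.Injective key)     (hone : ∀ w, key 1 ≤ key w)
    (hmul : ∀ a u v b, key u < key v → key (a * u * b) < key (a * v * b))
    {p q : FreeAssoc K A} (hp : p ∈ G) (hq : q ∈ G) {u v : FreeMonoid A} (hu : IsLead key p u)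
    (hv : IsLead key q v) {a b c d : FreeMonoid A} (h : a * u * b = c * v * d)
    (hl : a.length ≤ c.length) :
    (p.coeff u)⁻¹ • (mon K a * p * mon K b) - (q.coeff v)⁻¹ • (mon K c * q * mon K d) ∈
      below key G fun w => key w < key (a * u * b) := by
  obtain ⟨e, rfl, he⟩ := eq_mul_of_mul_eq_mul (a := a) (x := u * b) (c := c) (y := v * d)
    (by simpa [mul_assoc] using h) hl
  have hp0 : (p.coeff u)⁻¹ • p = mon K u + ((p.coeff u)⁻¹ • p - mon K u) := by abel
  have hq0 : (q.coeff v)⁻¹ • q = mon K v + ((q.coeff v)⁻¹ • q - mon K v) := by abel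
  have hpl := fun w => hu.lt_of_mem_support (v := w)
  have hql := fun w => hv.lt_of_mem_support (v := w)
  set p0 := (p.coeff u)⁻¹ • p - mon K u with hp0d
  set q0 := (q.coeff v)⁻¹ • q - mon K v with hq0d
  by_cases h1 : u.length ≤ e.length
  · obtain ⟨f, rfl, rfl⟩ := eq_mul_of_mul_eq_mul (a := u) (x := b) (c := e) (y := v * d)
      (by simpa [mul_assoc] using he) h1
    -- With `p`, `q` made monic, `p = u + p0` and `q = v + q0`, this is `p f v - u f q = p0 f q - p
    -- f q0`: both products on the right have leading words below `u f v`.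
    have key1 : (p.coeff u)⁻¹ • (mon K a * p * mon K (f * (v * d))) -
        (q.coeff v)⁻¹ • (mon K (a * (u * f)) * q * mon K d) =
        (q.coeff v)⁻¹ • (mon K a * (p0 * mon K f) * q * mon K d) -
        (p.coeff u)⁻¹ • (mon K a * p * (mon K f * q0 * mon K d)) := by
      simp only [hp0d, hq0d, ← mon_mul_mon, mul_sub, sub_mul, smul_sub, mul_smul_comm,
        smul_mul_assoc, mul_assoc, smul_comm (q.coeff v)⁻¹ (p.coeff u)⁻¹]
      abel
    clear_value p0 q0
    rw [key1]
    refine sub_mem (Submodule.smul_mem _ _ ?_) (Submodule.smul_mem _ _ ?_)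
    · refine mul_lead_mem_below hq hv fun w hw => ?_
      obtain ⟨w', hw', rfl⟩ := mem_support_mon_mul_mul_mon (a := 1) (b := f) (f := p0) (w := w)
        (by simpa [mon_one] using hw)
      simpa [mul_assoc] using hmul a w' u (f * (v * d)) (hpl _ hw')
    · refine lead_mul_mem_below hp hu fun w hw => ?_
      obtain ⟨w', hw', rfl⟩ := mem_support_mon_mul_mul_mon (a := f) (b := 1) (f := q0) (w := w)
        (by simpa [mon_one] using hw)
      simpa [mul_assoc] using hmul (a * u * f) w' v d (hql _ hw')
  · push Not at h1
    -- An empty `v` shares no letter with `u`, so `OverlapsResolve` says nothing about it. No word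
    -- is smaller than `1`, so `q` is then a nonzero constant and the tail `p0` is itself a
    -- combination of multiples of `q`.
    by_cases hv1 : v = 1
    · subst hv1
      have hq1 : q0 = 0 := by
        by_contra hne
        obtain ⟨w, hw⟩ := Letterplace.exists_isLead hinj hne
        exact absurd (hql w hw.1) (hone w).not_gt
      rw [hq1, add_zero, mon_one] at hq0
      have key1 : (p.coeff u)⁻¹ • (mon K a * p * mon K b) -
          (q.coeff 1)⁻¹ • (mon K (a * e) * q * mon K d) =
          (q.coeff 1)⁻¹ • (mon K a * p0 * q * mon K b) := by
        have : mon K u * mon K b = mon K e * mon K d := by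
          rw [mon_mul_mon, mon_mul_mon, he, one_mul]
        rw [← smul_mul_assoc, ← mul_smul_comm, ← smul_mul_assoc, ← mul_smul_comm,
          ← smul_mul_assoc, ← mul_smul_comm, hq0, hp0, mul_one, mul_one, mul_add, add_mul,
          mul_assoc, this, ← mon_mul_mon, mul_assoc, mul_assoc (mon K a) (mon K e)]
        abel
      rw [key1]
      refine Submodule.smul_mem _ _ (mul_lead_mem_below hq hv fun w hw => ?_)
      simpa using hmul a _ _ b (hpl _ hw)
    rcases le_total (e.length + v.length) u.length with h2 | h2
    · obtain ⟨f, rfl, rfl⟩ := eq_mul_of_mul_eq_mul (a := e * v) (x := d) (c := u) (y := b)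
        (by simpa [mul_assoc] using he.symm) (by simpa using h2)
      have := hS p hp q hq _ v hu hv e 1 f (by simp [mul_assoc]) (Or.inl rfl) h1 hv1
      have := mon_mul_mem_below (Q := fun w => key w < key (a * (e * v * f) * b)) a b this
        fun w hw => by simpa using hmul a _ _ b hw
      simpa [mul_sub, sub_mul, ← mon_mul_mon, mul_assoc, mon_one] using this
    · obtain ⟨f, h3, rfl⟩ := eq_mul_of_mul_eq_mul (a := u) (x := b) (c := e * v) (y := d)
        (by simpa [mul_assoc] using he) (by simpa using h2)
      have := hS p hp q hq _ v hu hv e f 1 (by simp [h3]) (Or.inr rfl) h1 hv1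
      have := mon_mul_mem_below (Q := fun w => key w < key (a * u * (f * d))) a d this
        fun w hw => by simpa [mul_assoc] using hmul a _ _ d hw
      simpa [mul_sub, sub_mul, ← mon_mul_mon, mul_assoc, mon_one] using this

theorem OverlapsResolve.sub_mem (hS : OverlapsResolve key G)
    (hinj : Function.Injective key)     (hone : ∀ w, key 1 ≤ key w)
    (hmul : ∀ a u v b, key u < key v → key (a * u * b) < key (a * v * b))
    {p q : FreeAssoc K A} (hp : p ∈ G) (hq : q ∈ G) {u v : FreeMonoid A} (hu : IsLead key p u)
    (hv : IsLead key q v) {a b c d : FreeMonoid A} (h : a * u * b = c * v * d) :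
    (p.coeff u)⁻¹ • (mon K a * p * mon K b) - (q.coeff v)⁻¹ • (mon K c * q * mon K d) ∈
      below key G fun w => key w < key (a * u * b) := by
  rcases le_total a.length c.length with hl | hl
  · exact hS.sub_mem_of_le hinj hone hmul hp hq hu hv h hl
  · rw [← neg_mem_iff, neg_sub, h]
    exact hS.sub_mem_of_le hinj hone hmul hq hp hv hu h.symm hl

/-- An element of the ideal generated by `G` is a multiple of an element of `G` up to terms with
smaller leading words. -/
theorem exists_sub_mem_below_of (hS : OverlapsResolve key G) (hinj : Function.Injective key)
    (hone : ∀ w, key 1 ≤ key w)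
    (hmul : ∀ a u v b, key u < key v → key (a * u * b) < key (a * v * b))
    (P : FreeMonoid A → Prop)
    (ih : ∀ u, P u → ∀ f ∈ below key G (fun w => key w < key u), f = 0 ∨
      ∃ g ∈ G, ∃ w a b, ∃ c : K, c ≠ 0 ∧ IsLead key g w ∧ key (a * w * b) < key u ∧
        f - c • (mon K a * g * mon K b) ∈ below key G fun v => key v < key (a * w * b))
    (hP : ∀ u v, P u → key v < key u → P v)
    (f : FreeAssoc K A) (hf : f ∈ below key G P) :
    f = 0 ∨ ∃ g ∈ G, ∃ w a b, ∃ c : K, c ≠ 0 ∧ IsLead key g w ∧ P (a * w * b) ∧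
        f - c • (mon K a * g * mon K b) ∈ below key G fun v => key v < key (a * w * b) := by
  have low : ∀ u v : FreeMonoid A, key u < key v → below key G (fun w => key w < key u) ≤
      below key G (fun w => key w < key v) :=
    fun u v huv => below_mono subset_rfl fun w hw => lt_trans hw huv
  induction hf using Submodule.span_induction with
  | mem x hx =>
    obtain ⟨g, hg, w, a, b, hw, hPw, rfl⟩ := hx
    exact Or.inr ⟨g, hg, w, a, b, 1, one_ne_zero, hw, hPw, by simp⟩
  | zero => exact Or.inl rfl
  | smul r x _ hx =>
    rcases eq_or_ne r 0 with rfl | hr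
    · simp
    rcases hx with rfl | ⟨g, hg, w, a, b, c, hc, hw, hPw, hx⟩
    · simp
    · refine Or.inr ⟨g, hg, w, a, b, r * c, mul_ne_zero hr hc, hw, hPw, ?_⟩
      rw [mul_smul, ← smul_sub]
      exact Submodule.smul_mem _ _ hx
  | add x y _ _ hx hy =>
    rcases hx with rfl | ⟨g, hg, w, a, b, c, hc, hw, hPw, hx⟩
    · simpa using hy
    rcases hy with rfl | ⟨g', hg', w', a', b', c', hc', hw', hPw', hy⟩
    · simp only [add_zero]
      exact Or.inr ⟨g, hg, w, a, b, c, hc, hw, hPw, hx⟩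
    rcases lt_trichotomy (key (a * w * b)) (key (a' * w' * b')) with hlt | heq | hlt
    · refine Or.inr ⟨g', hg', w', a', b', c', hc', hw', hPw', ?_⟩
      have h1 := add_mem (low _ _ hlt hx) hy
      have h2 := Submodule.smul_mem _ c (mul_mem_below (P := fun v => key v < key (a' * w' * b'))
        hg hw hlt)
      convert add_mem h1 h2 using 1
      abel
    · have hww := hinj heq
      have hd := hS.sub_mem hinj hone hmul hg hg' hw hw' hww
      set L := g.coeff w with hL
      set L' := g'.coeff w' with hL'
      have hL0 : L ≠ 0 := hw.coeff_ne_zero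
      have hL0' : L' ≠ 0 := hw'.coeff_ne_zero
      -- Equal leading words: the second multiple is exchanged for the first at the cost of smaller
      -- terms, the ratio of the leading coefficients entering the scalar.
      have hxy : x + y - (c + c' * L' * L⁻¹) • (mon K a * g * mon K b) ∈
          below key G fun v => key v < key (a * w * b) := by
        rw [heq] at hx
        rw [heq] at hd ⊢
        convert sub_mem (add_mem hx hy) (Submodule.smul_mem _ (c' * L') hd) using 1
        rw [smul_sub, smul_smul, smul_smul, mul_assoc c' L' L'⁻¹, mul_inv_cancel₀ hL0', mul_one,
          add_smul]
        abel
      -- If the leading terms cancel, the sum lies strictly below the common leading word, where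
      -- `ih` gives a representation.
      by_cases h0 : c + c' * L' * L⁻¹ = 0
      · rw [h0, zero_smul, sub_zero] at hxy
        rcases ih _ hPw _ hxy with h | ⟨g, hg, w1, a1, b1, c, hc, hw, hlt, h⟩
        · exact Or.inl h
        · exact Or.inr ⟨g, hg, w1, a1, b1, c, hc, hw, hP _ _ hPw hlt, h⟩
      · exact Or.inr ⟨g, hg, w, a, b, _, h0, hw, hPw, hxy⟩
    · refine Or.inr ⟨g, hg, w, a, b, c, hc, hw, hPw, ?_⟩
      have h1 := add_mem (low _ _ hlt hy) hx
      have h2 := Submodule.smul_mem _ c' (mul_mem_below (P := fun v => key v < key (a * w * b))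
        hg' hw' hlt)
      convert add_mem h1 h2 using 1
      abel

theorem mem_support_of_mem_below
    (hmul : ∀ a u v b, key u < key v → key (a * u * b) < key (a * v * b))
    (hP : ∀ u v, P u → key v < key u → P v) {f : FreeAssoc K A} (hf : f ∈ below key G P)
    {v : FreeMonoid A} (hv : v ∈ f.coeff.support) : P v := by
  induction hf using Submodule.span_induction with
  | mem x hx =>
    obtain ⟨g, hg, w, a, b, hw, hPw, rfl⟩ := hx
    by_cases e : v = a * w * b
    · rwa [e]
    · exact hP _ _ hPw ((hw.mul hmul a b).2 v hv e)
  | zero => simp at hv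
  | smul r x _ hx =>
    refine hx ?_
    simp only [Finsupp.mem_support_iff] at hv ⊢
    intro h
    simp [h] at hv
  | add x y _ _ hx hy =>
    by_cases h : v ∈ x.coeff.support
    · exact hx h
    · refine hy ?_
      simp only [Finsupp.mem_support_iff, not_not] at h hv ⊢
      simpa [h] using hv

/-- **Buchberger's criterion** in the free associative algebra. -/
theorem OverlapsResolve.exists_isLead [WellFoundedLT S] (hS : OverlapsResolve key G)
    (hinj : Function.Injective key)
    (hone : ∀ w, key 1 ≤ key w)
    (hmul : ∀ a u v b, key u < key v → key (a * u * b) < key (a * v * b))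
    {f : FreeAssoc K A} (hf : f ∈ below key G fun _ => True) (hf0 : f ≠ 0) :
    ∃ w, IsLead key f w ∧ ∃ g ∈ G, ∃ w', IsLead key g w' ∧ ∃ u v, w = u * w' * v := by
  -- Well-founded induction supplies the representation below every bound `u`; the same lemma then
  -- gives it without a bound.
  have step : ∀ s, ∀ u, key u = s → ∀ f ∈ below key G (fun w => key w < key u), f = 0 ∨
      ∃ g ∈ G, ∃ w a b, ∃ c : K, c ≠ 0 ∧ IsLead key g w ∧ key (a * w * b) < key u ∧
        f - c • (mon K a * g * mon K b) ∈ below key G fun v => key v < key (a * w * b) := by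
    intro s
    induction s using WellFoundedLT.induction with
    | ind s ih =>
      rintro u rfl
      exact exists_sub_mem_below_of hS hinj hone hmul _ (fun u' hu' => ih _ hu' u' rfl)
        fun _ _ h h' => lt_trans h' h
  obtain h | ⟨g, hg, w, a, b, c, hc, hw, -, h⟩ := exists_sub_mem_below_of hS hinj hone hmul
    (fun _ => True) (fun u _ => step _ u rfl) (fun _ _ _ _ => trivial) f hf
  · exact absurd h hf0
  refine ⟨a * w * b, ?_, g, hg, w, hw, a, b, rfl⟩
  have hlow := fun v => mem_support_of_mem_below (P := fun v => key v < key (a * w * b)) hmul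
    (fun _ _ h h' => lt_trans h' h) h (v := v)
  have hcoef : ∀ v, f.coeff v = (f - c • (mon K a * g * mon K b)).coeff v +
      c * (mon K a * g * mon K b).coeff v := fun v => by simp
  have hm := hw.mul hmul a b
  constructor
  · rw [Finsupp.mem_support_iff, hcoef]
    have : (f - c • (mon K a * g * mon K b)).coeff (a * w * b) = 0 := by
      by_contra h
      exact lt_irrefl _ (hlow _ (Finsupp.mem_support_iff.2 h))
    rw [this, zero_add]
    exact mul_ne_zero hc hm.coeff_ne_zero
  · intro v hv hne
    by_cases h1 : v ∈ (f - c • (mon K a * g * mon K b)).coeff.support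
    · exact hlow v h1
    · refine hm.2 v ?_ hne
      rw [Finsupp.mem_support_iff] at hv ⊢
      rw [Finsupp.notMem_support_iff] at h1
      rw [hcoef, h1, zero_add] at hv
      exact right_ne_zero_of_mul hv

/-- The span of all multiples `a g b` is closed under multiplication on both sides, hence a
two-sided ideal. The zero polynomial is left out of the hypothesis because it has no leading word.
-/
theorem span_le_below {H : Set (FreeAssoc K A)} (hinj : Function.Injective key)
    (h : ∀ f ∈ H, f ≠ 0 → f ∈ G) {f : FreeAssoc K A} (hf : f ∈ TwoSidedIdeal.span H) :
    f ∈ below key G fun _ => True := by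
  have hl : ∀ x y : FreeAssoc K A, y ∈ below key G (fun _ => True) →
      x * y ∈ below key G fun _ => True := by
    intro x y hy
    rw [← sum_smul_mon x, Finset.sum_mul]
    refine sum_mem fun v _ => ?_
    rw [smul_mul_assoc]
    simpa [mon_one] using Submodule.smul_mem _ _
      (mon_mul_mem_below (Q := fun _ => True) v 1 hy fun _ _ => trivial)
  have hr : ∀ x y : FreeAssoc K A, x ∈ below key G (fun _ => True) →
      x * y ∈ below key G fun _ => True := by
    intro x y hy
    rw [← sum_smul_mon y, Finset.mul_sum]
    refine sum_mem fun v _ => ?_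
    rw [mul_smul_comm]
    simpa [mon_one] using Submodule.smul_mem _ _
      (mon_mul_mem_below (Q := fun _ => True) 1 v hy fun _ _ => trivial)
  have := TwoSidedIdeal.span_le.2 (show H ⊆ (TwoSidedIdeal.mk'
    (below key G fun _ => True : Set (FreeAssoc K A)) (zero_mem _) add_mem neg_mem (hl _ _)
      (hr _ _)) from fun x hx => ?_) hf
  · simpa using this
  · rcases eq_or_ne x 0 with rfl | hx0
    · exact TwoSidedIdeal.zero_mem _
    obtain ⟨w, hw⟩ := Letterplace.exists_isLead hinj hx0
    have := mul_mem_below (P := fun _ => True) (a := 1) (b := 1) (h x hx hx0) hw trivial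
    simpa [mon_one] using this

end Words

/-! ### The monomials attached to words -/

section WordMonomials

variable {A : Type*}

/-- The shift of the places of a monomial. -/
noncomputable def shiftMon (i : ℕ) : ((A × ℕ) →₀ ℕ) →+ ((A × ℕ) →₀ ℕ) :=
  Finsupp.mapDomain.addMonoidHom fun v => (v.1, i + v.2)

theorem shiftMon_apply (i : ℕ) (m : (A × ℕ) →₀ ℕ) (a : A) (j : ℕ) :
    shiftMon i m (a, j) = if i ≤ j then m (a, j - i) else 0 := by
  have hinj : Function.Injective fun v : A × ℕ => (v.1, i + v.2) := by
    rintro ⟨a, j⟩ ⟨b, k⟩ h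
    simpa using h
  change Finsupp.mapDomain _ m (a, j) = _
  split_ifs with h
  · have : (a, j) = (fun v : A × ℕ => (v.1, i + v.2)) (a, j - i) := by simp [h]
    rw [this, Finsupp.mapDomain_apply hinj]
  · refine Finsupp.mapDomain_of_notMem_range _ _ ?_
    rintro ⟨⟨b, k⟩, hb⟩
    simp only [Prod.mk.injEq] at hb
    omega

theorem shiftMon_single (i : ℕ) (a : A) (j : ℕ) :
    shiftMon i (Finsupp.single (a, j) 1) = Finsupp.single (a, i + j) 1 :=
  Finsupp.mapDomain_single

theorem shiftMon_shiftMon (i j : ℕ) (m : (A × ℕ) →₀ ℕ) :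
    shiftMon i (shiftMon j m) = shiftMon (i + j) m := by
  change Finsupp.mapDomain _ (Finsupp.mapDomain _ m) = Finsupp.mapDomain _ m
  rw [← Finsupp.mapDomain_comp]
  congr 1
  ext v <;> simp [add_assoc]

@[simp]
theorem shiftMon_zero_left (m : (A × ℕ) →₀ ℕ) : shiftMon 0 m = m := by
  ext ⟨a, j⟩
  simp [shiftMon_apply]

@[simp]
theorem wordMon_one : wordMon (1 : FreeMonoid A) = 0 := rfl

theorem wordMon_of_mul (a : A) (w : FreeMonoid A) :
    wordMon (FreeMonoid.of a * w) = Finsupp.single (a, 0) 1 + shiftMon 1 (wordMon w) := by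
  simp only [wordMon, FreeMonoid.toList_of_mul, List.zipIdx_cons, List.map_cons, List.sum_cons,
    map_list_sum, List.map_map]
  rw [List.zipIdx_succ]
  simp only [List.map_map, Function.comp_def]
  congr 2
  refine List.map_congr_left fun x _ => ?_
  rw [shiftMon_single, add_comm 1 x.2]

theorem wordMon_of (a : A) : wordMon (FreeMonoid.of a) = Finsupp.single (a, 0) 1 := by
  simpa using wordMon_of_mul a 1

theorem wordMon_mul (u v : FreeMonoid A) :
    wordMon (u * v) = wordMon u + shiftMon u.length (wordMon v) := by
  induction u using FreeMonoid.inductionOn' with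
  | one => simp
  | of_mul a u ih =>
    rw [mul_assoc, wordMon_of_mul, ih, wordMon_of_mul, map_add, shiftMon_shiftMon, add_assoc,
      FreeMonoid.length_mul, FreeMonoid.length_of]

open Classical in
theorem wordMon_apply (w : FreeMonoid A) (a : A) (j : ℕ) :
    wordMon w (a, j) = if w.toList[j]? = some a then 1 else 0 := by
  induction w using FreeMonoid.inductionOn' generalizing j with
  | one => simp
  | of_mul b w ih =>
    rw [wordMon_of_mul, Finsupp.add_apply, shiftMon_apply, FreeMonoid.toList_of_mul]
    cases j with
    | zero => simp [Finsupp.single_apply]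
    | succ j => simp [ih]

theorem wordMon_injective : Function.Injective (wordMon : FreeMonoid A → _) := by
  classical
  intro u v h
  apply FreeMonoid.toList.injective
  apply List.ext_getElem?
  intro j
  ext a
  have := DFunLike.congr_fun h (a, j)
  rw [wordMon_apply, wordMon_apply] at this
  by_cases h1 : u.toList[j]? = some a <;> by_cases h2 : v.toList[j]? = some a <;> simp_all

/-- Divisibility by a shifted word monomial means that the letters of `v` are read in `w` from place
`i` on. The alternative `v = 1` is needed because the monomial `1` does not remember its shift, and
`i` may exceed the length of `w`. -/
theorem exists_eq_mul_of_shiftMon_le {i : ℕ} {v w : FreeMonoid A}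
    (h : shiftMon i (wordMon v) ≤ wordMon w) :
    ∃ a b, w = a * v * b ∧ (a.length = i ∨ v = 1) := by
  classical
  by_cases hv : v = 1
  · exact ⟨1, w, by simp [hv], Or.inr hv⟩
  have hget : ∀ (j : ℕ) x, v.toList[j]? = some x → w.toList[i + j]? = some x := by
    intro j x hx
    have := h (x, i + j)
    rw [shiftMon_apply, wordMon_apply, wordMon_apply] at this
    by_contra hne
    simp [hx, hne] at this
  have hpre : v.toList <+: w.toList.drop i := by
    rw [List.prefix_iff_getElem?]
    intro j hj
    rw [List.getElem?_drop]
    exact hget j _ (List.getElem?_eq_getElem hj)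
  obtain ⟨b, hb⟩ := hpre
  refine ⟨FreeMonoid.ofList (w.toList.take i), FreeMonoid.ofList b, ?_, Or.inl ?_⟩
  · rw [mul_assoc]
    change w.toList = w.toList.take i ++ (v.toList ++ b)
    rw [hb, List.take_append_drop]
  · change (w.toList.take i).length = i
    have hlen : 0 < v.toList.length := by
      rw [List.length_pos_iff]
      exact hv
    have : i < w.toList.length := by
      have := congrArg List.length hb
      simp only [List.length_append, List.length_drop] at this
      omega
    rw [List.length_take]
    omega

theorem shiftMon_wordMon_eq {i : ℕ} {a v : FreeMonoid A} (h : a.length = i ∨ v = 1) :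
    shiftMon i (wordMon v) = shiftMon a.length (wordMon v) := by
  rcases h with rfl | rfl
  · rfl
  · simp

theorem wordMon_mul_mul (a v b : FreeMonoid A) : wordMon (a * v * b) =
    wordMon a + shiftMon (a.length + v.length) (wordMon b) + shiftMon a.length (wordMon v) := by
  rw [wordMon_mul, wordMon_mul, FreeMonoid.length_mul]
  abel

/-! ### Multidegrees -/

theorem oneDeg_apply (d k : ℕ) : oneDeg d k = if k < d then 1 else 0 := by
  simp [oneDeg, Finsupp.finsetSum_apply, Finsupp.single_apply]

theorem oneDeg_succ (d : ℕ) : oneDeg (d + 1) = oneDeg d + Finsupp.single d 1 :=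
  Finset.sum_range_succ _ _

theorem multideg_add (m n : (A × ℕ) →₀ ℕ) : multideg (m + n) = multideg m + multideg n :=
  Finsupp.mapDomain_add

theorem wordMon_mul_of (w : FreeMonoid A) (a : A) :
    wordMon (w * FreeMonoid.of a) = wordMon w + Finsupp.single (a, w.length) 1 := by
  rw [wordMon_mul, wordMon_of, shiftMon_single, add_zero]

theorem multideg_wordMon (w : FreeMonoid A) : multideg (wordMon w) = oneDeg w.length := by
  obtain ⟨l, rfl⟩ := FreeMonoid.ofList.surjective w
  induction l using List.reverseRecOn with
  | nil => rfl
  | append_singleton l a ih =>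
    rw [FreeMonoid.ofList_append, FreeMonoid.ofList_singleton, wordMon_mul_of, multideg_add, ih,
      FreeMonoid.length_mul, FreeMonoid.length_of, oneDeg_succ]
    simp [multideg]

/-- One variable at each of the first places spells a word; in the induction the variable at the
last occupied place is split off as the last letter. -/
theorem exists_wordMon_eq_of_multideg_eq {d : ℕ} {m : (A × ℕ) →₀ ℕ} (h : multideg m = oneDeg d) :
    ∃ w : FreeMonoid A, w.length = d ∧ m = wordMon w := by
  classical
  induction d generalizing m with
  | zero =>
    refine ⟨1, rfl, ?_⟩
    ext ⟨a, j⟩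
    by_contra hne
    have hle : Finsupp.single (a, j) 1 ≤ m :=
      Finsupp.single_le_iff.2 (Nat.one_le_iff_ne_zero.2 hne)
    rw [← add_tsub_cancel_of_le hle, multideg_add] at h
    simpa [multideg, oneDeg] using DFunLike.congr_fun h j
  | succ d ih =>
    have hd : d ∈ (multideg m).support := by
      rw [Finsupp.mem_support_iff, h, oneDeg_apply]
      simp
    obtain ⟨⟨a, j⟩, haj, rfl⟩ := Finset.mem_image.1 (Finsupp.mapDomain_support hd)
    have hle : Finsupp.single (a, j) 1 ≤ m :=
      Finsupp.single_le_iff.2 (Nat.one_le_iff_ne_zero.2 (Finsupp.mem_support_iff.1 haj))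
    obtain ⟨w, hw, hm⟩ := ih (m := m - Finsupp.single (a, j) 1) (by
      rw [← tsub_add_cancel_of_le hle, multideg_add, oneDeg_succ] at h
      simpa [multideg] using h)
    refine ⟨w * FreeMonoid.of a, by simp [hw], ?_⟩
    rw [wordMon_mul_of, ← hm, hw]
    exact (tsub_add_cancel_of_le hle).symm

/-! ### The ordering of the words -/

variable (ord : MonomialOrder A)

theorem factors_apply (m : (A × ℕ) →₀ ℕ) (j : ℕ) (a : A) : factors A m j a = m (a, j) := rfl

theorem placeOrder_lt_iff {m n : (A × ℕ) →₀ ℕ} :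
    (placeOrder ord).toSyn m < (placeOrder ord).toSyn n ↔
      ∃ j, (∀ k, j < k → factors A m k = factors A n k) ∧
        ord.toSyn (factors A m j) < ord.toSyn (factors A n j) := by
  refine Finsupp.Colex.lt_iff.trans ?_
  simp only [placeOrder]
  constructor
  · rintro ⟨j, h1, h2⟩
    exact ⟨j, fun k hk => ord.toSyn.injective (h1 k hk), h2⟩
  · rintro ⟨j, h1, h2⟩
    exact ⟨j, fun k hk => congrArg ord.toSyn (h1 k hk), h2⟩

/-- The position of a word in the ordering of the words. -/
noncomputable def wordKey (w : FreeMonoid A) : (placeOrder ord).syn :=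
  (placeOrder ord).toSyn (wordMon w)

theorem wordKey_injective : Function.Injective (wordKey ord) :=
  (placeOrder ord).toSyn.injective.comp wordMon_injective

theorem wordKey_one_le (w : FreeMonoid A) : wordKey ord 1 ≤ wordKey ord w := by
  simp [wordKey]

/-- At the last place of `v`, which is `v.length - 1` with places counted from `0`, the factor of
`u` is `1` and that of `v` is a variable; beyond it both are `1`. Hence the ordering is graded. -/
theorem wordKey_lt_of_length_lt {u v : FreeMonoid A} (h : u.length < v.length) :
    wordKey ord u < wordKey ord v := by
  classical
  have hz : ∀ (w : FreeMonoid A) (k : ℕ), w.length ≤ k → factors A (wordMon w) k = 0 := by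
    intro w k hk
    ext a
    rw [factors_apply, wordMon_apply, List.getElem?_eq_none hk]
    simp
  refine (placeOrder_lt_iff ord).2 ⟨v.length - 1, fun k hk => ?_, ?_⟩
  · rw [hz u k (by omega), hz v k (by omega)]
  · rw [hz u _ (by omega)]
    refine ord.toSyn_strictMono (pos_of_ne_zero fun h0 => ?_)
    have hv : v.length - 1 < v.toList.length := Nat.sub_one_lt_of_lt h
    have := DFunLike.congr_fun h0 (v.toList[v.length - 1])
    rw [factors_apply, wordMon_apply, List.getElem?_eq_getElem hv] at this
    simp at this

/-- At equal length the last letters decide, whatever stands before them. With `t` smallest, this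
puts words ending in `t` below words ending in a letter of `X`. -/
theorem wordKey_mul_of_lt {u v : FreeMonoid A} (hl : u.length = v.length) {a b : A}
    (h : ord.toSyn (Finsupp.single a 1) < ord.toSyn (Finsupp.single b 1)) :
    wordKey ord (u * FreeMonoid.of a) < wordKey ord (v * FreeMonoid.of b) := by
  classical
  have hz : ∀ (w : FreeMonoid A) (x : A), factors A (wordMon (w * FreeMonoid.of x)) w.length =
      Finsupp.single x 1 := by
    intro w x
    ext y
    rw [factors_apply, wordMon_apply]
    have : (w * FreeMonoid.of x).toList[w.length]? = some x :=
      List.getElem?_concat_length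
    rw [this]
    simp [Finsupp.single_apply]
  refine (placeOrder_lt_iff ord).2 ⟨v.length, fun k hk => ?_, ?_⟩
  · ext y
    rw [factors_apply, factors_apply, wordMon_apply, wordMon_apply, List.getElem?_eq_none,
      List.getElem?_eq_none]
    · exact (FreeMonoid.length_mul v _).trans_le hk
    · exact (FreeMonoid.length_mul u _).trans_le (by rw [hl]; exact hk)
  · rw [hz v, ← hl, hz u]
    exact h

theorem shiftMon_lt (i : ℕ) {m n : (A × ℕ) →₀ ℕ}
    (h : (placeOrder ord).toSyn m < (placeOrder ord).toSyn n) :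
    (placeOrder ord).toSyn (shiftMon i m) < (placeOrder ord).toSyn (shiftMon i n) := by
  obtain ⟨j, h1, h2⟩ := (placeOrder_lt_iff ord).1 h
  have hs : ∀ (m : (A × ℕ) →₀ ℕ) k, factors A (shiftMon i m) (i + k) = factors A m k := by
    intro m k
    ext a
    simp [factors_apply, shiftMon_apply]
  refine (placeOrder_lt_iff ord).2 ⟨i + j, fun k hk => ?_, by rwa [hs, hs]⟩
  obtain ⟨k, rfl⟩ := Nat.exists_eq_add_of_le (show i ≤ k by omega)
  rw [hs, hs, h1 k (by omega)]

/-- The places of `b` depend on the length of the middle word, so this is not just compatibility of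
the monomial ordering with products. Different lengths are settled by gradedness; for equal lengths
both sides have the same letterplace cofactor. -/
theorem wordKey_mul_lt (a u v b : FreeMonoid A) (h : wordKey ord u < wordKey ord v) :
    wordKey ord (a * u * b) < wordKey ord (a * v * b) := by
  rcases lt_trichotomy u.length v.length with hl | hl | hl
  · exact wordKey_lt_of_length_lt ord (by simp [hl])
  · unfold wordKey at h ⊢
    rw [wordMon_mul_mul, wordMon_mul_mul, hl, map_add, map_add (placeOrder ord).toSyn _
      (shiftMon a.length (wordMon v))]
    exact add_lt_add_right (shiftMon_lt ord _ h) _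
  · exact absurd h (wordKey_lt_of_length_lt ord hl).not_gt

end WordMonomials

/-! ### The letterplace embedding -/

section Embedding

variable {K A : Type*} [Field K]

/-- All words of `f` have length `n`. -/
def IsHomog (f : FreeAssoc K A) (n : ℕ) : Prop :=
  ∀ w ∈ f.coeff.support, w.length = n

theorem embed_apply (f : FreeAssoc K A) :
    embed K A f = ∑ w ∈ f.coeff.support, monomial (wordMon w) (f.coeff w) := rfl

theorem coeff_embed (f : FreeAssoc K A) (w : FreeMonoid A) :
    (embed K A f).coeff (wordMon w) = f.coeff w := by
  classical
  simp only [embed_apply, coeff_sum, coeff_monomial, wordMon_injective.eq_iff]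
  rw [Finset.sum_ite_eq']
  simp only [Finsupp.mem_support_iff, ne_eq, ite_not, ite_eq_right_iff]
  exact Eq.symm

theorem exists_of_mem_support_embed {f : FreeAssoc K A} {m : (A × ℕ) →₀ ℕ}
    (h : m ∈ (embed K A f).support) : ∃ w ∈ f.coeff.support, m = wordMon w := by
  classical
  obtain ⟨w, hw, h1⟩ := Finset.mem_biUnion.1 (support_sum h)
  exact ⟨w, hw, Finset.mem_singleton.1 (support_monomial_subset h1)⟩

theorem wordMon_mem_support_embed {f : FreeAssoc K A} {w : FreeMonoid A} :
    wordMon w ∈ (embed K A f).support ↔ w ∈ f.coeff.support := by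
  rw [MvPolynomial.mem_support_iff, coeff_embed, Finsupp.mem_support_iff]

theorem embed_injective : Function.Injective (embed K A) := by
  intro f g h
  ext w
  rw [← coeff_embed, h, coeff_embed]

theorem embed_mon (w : FreeMonoid A) : embed K A (mon K w) = monomial (wordMon w) 1 := by
  rw [embed_apply, mon, MonoidAlgebra.coeff_single, Finsupp.support_single _ one_ne_zero]
  simp

variable (ord : MonomialOrder A)

theorem degree_embed {f : FreeAssoc K A} {w : FreeMonoid A} (h : IsLead (wordKey ord) f w) :
    (placeOrder ord).degree (embed K A f) = wordMon w := by
  apply (placeOrder ord).toSyn.injective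
  apply le_antisymm
  · rw [MonomialOrder.degree_le_iff]
    intro m hm
    obtain ⟨v, hv, rfl⟩ := exists_of_mem_support_embed hm
    by_cases e : v = w
    · rw [e]
    · exact (h.2 v hv e).le
  · exact MonomialOrder.le_degree (wordMon_mem_support_embed.2 h.1)

theorem leadingCoeff_embed {f : FreeAssoc K A} {w : FreeMonoid A}
    (h : IsLead (wordKey ord) f w) :
    (placeOrder ord).leadingCoeff (embed K A f) = f.coeff w := by
  rw [MonomialOrder.leadingCoeff, degree_embed ord h, coeff_embed]

theorem shift_injective_aux (i : ℕ) :
    Function.Injective fun v : A × ℕ => (v.1, i + v.2) := by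
  rintro ⟨a, j⟩ ⟨b, k⟩ h
  simpa using h

theorem shift_monomial (i : ℕ) (m : (A × ℕ) →₀ ℕ) (c : K) :
    shift i (monomial m c : LPAlg K A) = monomial (shiftMon i m) c :=
  rename_monomial _ _ _

theorem coeff_shift (i : ℕ) (p : LPAlg K A) (m : (A × ℕ) →₀ ℕ) :
    (shift i p).coeff (shiftMon i m) = p.coeff m :=
  coeff_rename_mapDomain _ (shift_injective_aux i) _ _

theorem shift_ne_zero (i : ℕ) {p : LPAlg K A} (hp : p ≠ 0) : shift i p ≠ 0 :=
  (map_ne_zero_iff _ (rename_injective _ (shift_injective_aux i))).2 hp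

@[simp]
theorem shift_zero_left (p : LPAlg K A) : shift 0 p = p := by
  have : (fun v : A × ℕ => (v.1, 0 + v.2)) = id := by ext <;> simp
  rw [shift, this, rename_id_apply]

theorem degree_shift (i : ℕ) {p : LPAlg K A} (hp : p ≠ 0) :
    (placeOrder ord).degree (shift i p) = shiftMon i ((placeOrder ord).degree p) := by
  classical
  apply (placeOrder ord).toSyn.injective
  apply le_antisymm
  · rw [MonomialOrder.degree_le_iff]
    intro m hm
    rw [shift, support_rename_of_injective (shift_injective_aux i)] at hm
    obtain ⟨n, hn, rfl⟩ := Finset.mem_image.1 hm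
    rcases (MonomialOrder.le_degree (m := placeOrder ord) hn).eq_or_lt with h | h
    · rw [(placeOrder ord).toSyn.injective h]
      exact le_rfl
    · exact (shiftMon_lt ord i h).le
  · apply MonomialOrder.le_degree
    rw [MvPolynomial.mem_support_iff, coeff_shift, MonomialOrder.coeff_degree_ne_zero_iff]
    exact hp

theorem leadingCoeff_shift (i : ℕ) {p : LPAlg K A} (hp : p ≠ 0) :
    (placeOrder ord).leadingCoeff (shift i p) = (placeOrder ord).leadingCoeff p := by
  rw [MonomialOrder.leadingCoeff, degree_shift ord i hp, coeff_shift]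
  rfl

theorem IsLead.embed_ne_zero {f : FreeAssoc K A} {w : FreeMonoid A}
    (h : IsLead (wordKey ord) f w) : embed K A f ≠ 0 := by
  intro h0
  have := wordMon_mem_support_embed.2 h.1
  simp [h0] at this

theorem degree_shift_embed (i : ℕ) {f : FreeAssoc K A} {w : FreeMonoid A}
    (h : IsLead (wordKey ord) f w) :
    (placeOrder ord).degree (shift i (embed K A f)) = shiftMon i (wordMon w) := by
  rw [degree_shift ord i (h.embed_ne_zero ord), degree_embed ord h]

/-- Homogeneity is essential: `b` stands at the same places behind every word of `f`, so one
monomial cofactor serves all terms. For `n = 0` the polynomial `f` is a constant and the shift is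
irrelevant. -/
theorem monomial_mul_shift_embed {f : FreeAssoc K A} {n i : ℕ} (hf : IsHomog f n)
    {a b : FreeMonoid A} (hi : a.length = i ∨ n = 0) (c : K) :
    monomial (wordMon a + shiftMon (a.length + n) (wordMon b)) c * shift i (embed K A f) =
      embed K A (c • (mon K a * f * mon K b)) := by
  conv_rhs => rw [← sum_smul_mon f, Finset.mul_sum, Finset.sum_mul, Finset.smul_sum, map_sum]
  rw [embed_apply, map_sum, Finset.mul_sum]
  refine Finset.sum_congr rfl fun w hw => ?_
  rw [shift_monomial, monomial_mul, mul_smul_comm, smul_mul_assoc, mon_mul_mon, mon_mul_mon,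
    map_smul, map_smul, embed_mon, wordMon_mul_mul, smul_monomial, smul_monomial, hf w hw,
    shiftMon_wordMon_eq (i := i) (a := a)]
  · simp
  · rcases hi with h | h
    · exact Or.inl h
    · exact Or.inr (FreeMonoid.length_eq_zero.1 ((hf w hw).trans h))

/-- Once the lcm is the monomial of the word `u r = e v d`, the two cofactors are those of
multiplication by `r` on the right and by `e`, `d` on both sides. -/
theorem spoly_embed {f g : FreeAssoc K A} {u v e r d : FreeMonoid A} {i : ℕ}
    (hf : IsHomog f u.length) (hg : IsHomog g v.length) (hu : IsLead (wordKey ord) f u)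
    (hv : IsLead (wordKey ord) g v) (h : u * r = e * v * d) (hi : e.length = i ∨ v = 1)
    (hsup : wordMon u ⊔ shiftMon i (wordMon v) = wordMon (u * r)) :
    spoly (placeOrder ord) (embed K A f) (shift i (embed K A g)) =
      embed K A ((f.coeff u)⁻¹ • (f * mon K r) - (g.coeff v)⁻¹ • (mon K e * g * mon K d)) := by
  rw [spoly, degree_shift_embed ord i hv, degree_embed ord hu, leadingCoeff_embed ord hu,
    leadingCoeff_shift ord i (hv.embed_ne_zero ord), leadingCoeff_embed ord hv, hsup, map_sub]
  congr 1
  · have := monomial_mul_shift_embed hf (a := 1) (b := r) (i := 0) (Or.inl rfl) (f.coeff u)⁻¹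
    rw [wordMon_mul, add_tsub_cancel_left]
    simpa using this
  · have := monomial_mul_shift_embed hg (a := e) (b := d) (i := i)
      (hi.imp id fun h => by rw [h]; rfl) (g.coeff v)⁻¹
    rw [h, wordMon_mul_mul, shiftMon_wordMon_eq hi, add_tsub_cancel_right, this]

/-- Every step of reduction of the image of `f` modulo the orbit of a set of images of homogeneous
elements comes from a subtraction of a multiple in the free associative algebra. -/
theorem ReduceStep.exists_eq_embed {G : Set (LPAlg K A)}
    (hG : ∀ p ∈ G, ∃ g w, IsHomog g w.length ∧ IsLead (wordKey ord) g w ∧ p = embed K A g)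
    {f : FreeAssoc K A} {q : LPAlg K A}
    (h : ReduceStep (placeOrder ord) (shifts G) (embed K A f) q) :
    ∃ g w a b, ∃ c : K, embed K A g ∈ G ∧ IsHomog g w.length ∧ IsLead (wordKey ord) g w ∧
      a * w * b ∈ f.coeff.support ∧ q = embed K A (f - c • (mon K a * g * mon K b)) := by
  obtain ⟨_, ⟨i, p, hp, rfl⟩, -, m, hm, rfl⟩ := h
  obtain ⟨g, w, hg, hw, rfl⟩ := hG p hp
  rw [degree_shift_embed ord i hw] at hm ⊢
  -- The cancelled monomial comes from a word `z` of `f`, so divisibility by the shifted leading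
  -- monomial becomes a factorization of `z`.
  obtain ⟨z, hz, hmz⟩ := exists_of_mem_support_embed hm
  obtain ⟨a, b, rfl, hi⟩ := exists_eq_mul_of_shiftMon_le (i := i) (v := w) (w := z)
    (hmz ▸ le_add_self)
  generalize (embed K A f).coeff (m + shiftMon i (wordMon w)) /
    (placeOrder ord).leadingCoeff (shift i (embed K A g)) = c
  refine ⟨g, w, a, b, c, hp, hg, hw, hz, ?_⟩
  rw [map_sub, ← monomial_mul_shift_embed hg (i := i) (hi.imp id fun h => by rw [h]; rfl)]
  rw [wordMon_mul_mul, ← shiftMon_wordMon_eq hi] at hmz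
  rw [add_right_cancel hmz]

theorem IsNormal.ne_mul {G : Set (LPAlg K A)} {f g : FreeAssoc K A}
    (h : IsNormal (placeOrder ord) (shifts G) (embed K A f)) (hg : embed K A g ∈ G)
    {w : FreeMonoid A} (hw : IsLead (wordKey ord) g w) {v : FreeMonoid A}
    (hv : v ∈ f.coeff.support) (a b : FreeMonoid A) : v ≠ a * w * b := by
  rintro rfl
  refine h _ (wordMon_mem_support_embed.2 hv) (shift a.length (embed K A g)) ⟨_, _, hg, rfl⟩
    (shift_ne_zero _ (hw.embed_ne_zero ord)) ?_
  rw [degree_shift_embed ord _ hw, wordMon_mul_mul]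
  exact le_add_self

theorem IsHomog.mon_mul_mul_mon {f : FreeAssoc K A} {n : ℕ} (h : IsHomog f n)
    (a b : FreeMonoid A) : IsHomog (mon K a * f * mon K b) (a.length + n + b.length) := by
  intro w hw
  obtain ⟨v, hv, rfl⟩ := mem_support_mon_mul_mul_mon hw
  simp [h v hv]

theorem mem_support_sub {f g : FreeAssoc K A} {w : FreeMonoid A}
    (h : w ∈ (f - g).coeff.support) : w ∈ f.coeff.support ∨ w ∈ g.coeff.support := by
  classical
  exact Finset.mem_union.1 (Finsupp.support_sub h)

theorem mem_support_smul {c : K} {g : FreeAssoc K A} {w : FreeMonoid A}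
    (h : w ∈ (c • g).coeff.support) : w ∈ g.coeff.support :=
  Finsupp.support_smul h

end Embedding

/-! ### Homogenization and dehomogenization -/

section Homogenization

variable {K X : Type*} [Field K]

/-- The word obtained by erasing the letters `t`. -/
def eraseT : FreeMonoid (Ext X) →* FreeMonoid X :=
  FreeMonoid.lift fun a => a.elim 1 FreeMonoid.of

@[simp]
theorem eraseT_map (v : FreeMonoid X) : eraseT (FreeMonoid.map some v) = v := by
  have : (eraseT (X := X)).comp (FreeMonoid.map some) = MonoidHom.id _ :=
    FreeMonoid.hom_eq fun x => by simp [eraseT]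
  exact DFunLike.congr_fun this v

@[simp]
theorem eraseT_of_none : eraseT (FreeMonoid.of (none : Ext X)) = 1 := by simp [eraseT]

@[simp]
theorem eraseT_of_some (x : X) : eraseT (FreeMonoid.of (some x : Ext X)) = FreeMonoid.of x := by
  simp [eraseT]

theorem eraseT_map_mul_pow (v : FreeMonoid X) (k : ℕ) :
    eraseT (FreeMonoid.map some v * FreeMonoid.of none ^ k) = v := by simp

theorem length_eraseT_le (w : FreeMonoid (Ext X)) : (eraseT w).length ≤ w.length := by
  induction w using FreeMonoid.inductionOn' with
  | one => simp
  | of_mul a w ih => cases a <;> simp <;> omega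

theorem map_eraseT_of_length_eq {w : FreeMonoid (Ext X)} (h : (eraseT w).length = w.length) :
    FreeMonoid.map some (eraseT w) = w := by
  induction w using FreeMonoid.inductionOn' with
  | one => simp
  | of_mul a w ih =>
    cases a with
    | none =>
      have := length_eraseT_le w
      simp at h
      omega
    | some x =>
      simp at h
      simp [ih h]

@[simp]
theorem length_map {A B : Type*} (f : A → B) (w : FreeMonoid A) :
    (FreeMonoid.map f w).length = w.length := List.length_map _

@[simp]
theorem length_pow {A : Type*} (w : FreeMonoid A) (k : ℕ) : (w ^ k).length = k * w.length := by
  induction k with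
  | zero => simp
  | succ k ih => rw [pow_succ, FreeMonoid.length_mul, ih, Nat.succ_mul]

theorem map_some_injective :
    Function.Injective (FreeMonoid.map some : FreeMonoid X → FreeMonoid (Ext X)) :=
  Function.LeftInverse.injective eraseT_map

theorem dehom_mon (w : FreeMonoid (Ext X)) : dehom K X (mon K w) = mon K (eraseT w) := by
  have h : (FreeMonoid.lift fun a : Ext X =>
      a.elim 1 fun x => MonoidAlgebra.of K (FreeMonoid X) (FreeMonoid.of x)) =
      (MonoidAlgebra.of K (FreeMonoid X)).comp eraseT :=
    FreeMonoid.hom_eq fun a => by cases a <;> simp [MonoidAlgebra.one_def]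
  rw [dehom, mon, MonoidAlgebra.lift_single, h, one_smul]
  rfl

theorem dehom_apply (f : FreeAssoc K (Ext X)) :
    dehom K X f = ∑ w ∈ f.coeff.support, f.coeff w • mon K (eraseT w) := by
  conv_lhs => rw [← sum_smul_mon f, map_sum]
  simp [dehom_mon]

/-- The word `v`, filled up with letters `t` to the length `n`. -/
def padT (n : ℕ) (v : FreeMonoid X) : FreeMonoid (Ext X) :=
  FreeMonoid.map some v * FreeMonoid.of none ^ (n - v.length)

@[simp]
theorem eraseT_padT (n : ℕ) (v : FreeMonoid X) : eraseT (padT n v) = v :=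
  eraseT_map_mul_pow _ _

theorem length_padT {n : ℕ} {v : FreeMonoid X} (h : v.length ≤ n) : (padT n v).length = n := by
  simp [padT, h]

theorem padT_length (v : FreeMonoid X) : padT v.length v = FreeMonoid.map some v := by
  simp [padT]

theorem padT_injective (n : ℕ) : Function.Injective (padT n : FreeMonoid X → _) :=
  Function.LeftInverse.injective (eraseT_padT n)

theorem homogenize_apply (f : FreeAssoc K X) :
    homogenize f = ∑ v ∈ f.coeff.support, f.coeff v • mon K (padT (topDegree f) v) := by
  simp [homogenize, padT, mon]

theorem coeff_homogenize (f : FreeAssoc K X) (v : FreeMonoid X) :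
    (homogenize f).coeff (padT (topDegree f) v) = f.coeff v := by
  classical
  simp only [homogenize_apply, mon, MonoidAlgebra.coeff_sum, Finsupp.finsetSum_apply,
    MonoidAlgebra.coeff_smul, MonoidAlgebra.coeff_single, Finsupp.smul_apply, Finsupp.single_apply,
    (padT_injective _).eq_iff, smul_eq_mul, mul_ite, mul_one, mul_zero, Finset.sum_ite_eq']
  simp only [Finsupp.mem_support_iff, ne_eq, ite_not, ite_eq_right_iff]
  exact Eq.symm

theorem exists_of_mem_support_homogenize {f : FreeAssoc K X} {w : FreeMonoid (Ext X)}
    (h : w ∈ (homogenize f).coeff.support) :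
    ∃ v ∈ f.coeff.support, w = padT (topDegree f) v := by
  classical
  rw [homogenize_apply, MonoidAlgebra.coeff_sum] at h
  obtain ⟨v, hv, h1⟩ := Finset.mem_biUnion.1 (Finsupp.support_finsetSum h)
  refine ⟨v, hv, ?_⟩
  exact Finset.mem_singleton.1 (Finsupp.support_single_subset (mem_support_smul h1))

theorem length_le_topDegree {f : FreeAssoc K X} {v : FreeMonoid X} (h : v ∈ f.coeff.support) :
    v.length ≤ topDegree f := Finset.le_sup h

theorem isHomog_homogenize (f : FreeAssoc K X) : IsHomog (homogenize f) (topDegree f) := by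
  intro w hw
  obtain ⟨v, hv, rfl⟩ := exists_of_mem_support_homogenize hw
  exact length_padT (length_le_topDegree hv)

theorem dehom_homogenize (f : FreeAssoc K X) : dehom K X (homogenize f) = f := by
  rw [homogenize_apply, map_sum]
  simp only [map_smul, dehom_mon, eraseT_padT]
  exact sum_smul_mon f

/-! ### Leading words of homogenizations and commutators. -/

section Ordering

variable (ord : MonomialOrder (Ext X))

/-- The position of a word over `X` in the ordering of the words over `X ∪ {t}`. -/
noncomputable def extKey (w : FreeMonoid X) : (placeOrder ord).syn :=
  wordKey ord (FreeMonoid.map some w)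

theorem extKey_injective : Function.Injective (extKey ord) :=
  (wordKey_injective ord).comp map_some_injective

theorem extKey_one_le (w : FreeMonoid X) : extKey ord 1 ≤ extKey ord w := by
  simpa [extKey] using wordKey_one_le ord (FreeMonoid.map some w)

theorem extKey_mul_lt (a u v b : FreeMonoid X) (h : extKey ord u < extKey ord v) :
    extKey ord (a * u * b) < extKey ord (a * v * b) := by
  simpa [extKey] using wordKey_mul_lt ord (FreeMonoid.map some a) _ _ (FreeMonoid.map some b) h

/-- Erasing letters `t` does not destroy the inequality with a word over `X` of the same length. -/
theorem extKey_eraseT_lt {w : FreeMonoid (Ext X)} {v : FreeMonoid X} (hl : w.length = v.length)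
    (h : wordKey ord w < extKey ord v) : extKey ord (eraseT w) < extKey ord v := by
  rcases (length_eraseT_le w).lt_or_eq with h1 | h1
  · exact wordKey_lt_of_length_lt ord (by simpa [← hl] using h1)
  · rwa [extKey, map_eraseT_of_length_eq h1]

variable {ord}

theorem IsLead.length_eq_topDegree {f : FreeAssoc K X} {w : FreeMonoid X}
    (h : IsLead (extKey ord) f w) : w.length = topDegree f := by
  refine le_antisymm (length_le_topDegree h.1) (Finset.sup_le fun v hv => ?_)
  by_contra! hlt
  have h1 : extKey ord w < extKey ord v := wordKey_lt_of_length_lt ord (by simpa using hlt)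
  exact lt_asymm h1 (h.2 v hv (by rintro rfl; exact lt_irrefl _ h1))

/-- Words of top degree are unchanged. A shorter word is padded on the right, so it ends in `t`,
while the leading word has the same length and ends in a letter of `X`; the last place decides. -/
theorem IsLead.homogenize
    (ht : ∀ x : X, ord.toSyn (Finsupp.single none 1) < ord.toSyn (Finsupp.single (some x) 1))
    {f : FreeAssoc K X} {w : FreeMonoid X} (h : IsLead (extKey ord) f w) :
    IsLead (wordKey ord) (homogenize f) (FreeMonoid.map some w) := by
  have hw := h.length_eq_topDegree
  refine ⟨?_, fun z hz hne => ?_⟩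
  · rw [Finsupp.mem_support_iff, ← padT_length, hw, coeff_homogenize]
    exact h.coeff_ne_zero
  · obtain ⟨v, hv, rfl⟩ := exists_of_mem_support_homogenize hz
    rw [← hw] at hne ⊢
    have hle := length_le_topDegree hv
    rw [← hw] at hle
    rcases hle.eq_or_lt with hl | hl
    · rw [← hl, padT_length] at hne ⊢
      exact h.2 v hv fun e => hne (by rw [e])
    · obtain ⟨k, hk⟩ := Nat.exists_eq_add_of_lt hl
      obtain ⟨l, rfl⟩ := FreeMonoid.ofList.surjective w
      rcases List.eq_nil_or_concat l with rfl | ⟨l, x, rfl⟩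
      · simp at hl
      · have h1 : (FreeMonoid.ofList (l.concat x)).length = (FreeMonoid.ofList l).length + 1 :=
          List.length_concat
        have h2 : FreeMonoid.ofList (l.concat x) = FreeMonoid.ofList l * FreeMonoid.of x :=
          List.concat_eq_append
        have h3 : (FreeMonoid.ofList (l.concat x)).length - v.length = k + 1 := by omega
        rw [padT, h3, pow_succ, ← mul_assoc, h2, map_mul, FreeMonoid.map_of]
        refine wordKey_mul_of_lt ord ?_ (ht x)
        simp only [FreeMonoid.length_mul, length_map, length_pow, FreeMonoid.length_of]
        omega

theorem coeff_homogenize_lead {f : FreeAssoc K X} {w : FreeMonoid X}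
    (h : IsLead (extKey ord) f w) :
    (homogenize f).coeff (FreeMonoid.map some w) = f.coeff w := by
  rw [← padT_length, h.length_eq_topDegree, coeff_homogenize]

theorem commutator_eq (x : X) : tVar K X * xVar K x - xVar K x * tVar K X =
    mon K (FreeMonoid.of none * FreeMonoid.of (some x)) -
      mon K (FreeMonoid.of (some x) * FreeMonoid.of none) := by
  rw [← mon_mul_mon, ← mon_mul_mon]
  rfl

theorem isLead_commutator
    (ht : ∀ x : X, ord.toSyn (Finsupp.single none 1) < ord.toSyn (Finsupp.single (some x) 1))
    (x : X) : IsLead (wordKey ord) (tVar K X * xVar K x - xVar K x * tVar K X)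
      (FreeMonoid.of none * FreeMonoid.of (some x)) := by
  have hne : FreeMonoid.of (some x) * FreeMonoid.of none ≠
      FreeMonoid.of (none : Ext X) * FreeMonoid.of (some x) := by
    intro h
    have h1 := congrArg FreeMonoid.toList h
    simp at h1
  rw [commutator_eq]
  refine ⟨?_, fun v hv hvne => ?_⟩
  · simp [mon, hne]
  · rcases mem_support_sub hv with h | h
    · exact absurd (Finset.mem_singleton.1 (Finsupp.support_single_subset h)) hvne
    · rw [Finset.mem_singleton.1 (Finsupp.support_single_subset h)]
      exact wordKey_mul_of_lt ord (u := FreeMonoid.of (some x)) (v := FreeMonoid.of none)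
        (by simp) (ht x)

end Ordering

theorem isHomog_commutator (x : X) :
    IsHomog (tVar K X * xVar K x - xVar K x * tVar K X) 2 := by
  intro v hv
  rw [commutator_eq] at hv
  rcases mem_support_sub hv with h | h <;>
    rw [Finset.mem_singleton.1 (Finsupp.support_single_subset h)] <;> rfl

theorem dehom_commutator (x : X) :
    dehom K X (tVar K X * xVar K x - xVar K x * tVar K X) = 0 := by
  simp [commutator_eq, dehom_mon]

/-- A word in which no letter `t` stands before a letter of `X` has all letters `t` at the end. -/
theorem eq_padT_eraseT {w : FreeMonoid (Ext X)}
    (h : ∀ a b (x : X), w ≠ a * (FreeMonoid.of none * FreeMonoid.of (some x)) * b) :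
    w = padT w.length (eraseT w) := by
  induction w using FreeMonoid.inductionOn' with
  | one => simp [padT]
  | of_mul c w ih =>
    have hw := ih fun a b x e => h (FreeMonoid.of c * a) b x (by rw [e]; simp only [mul_assoc])
    have hl := length_eraseT_le w
    cases c with
    | some x =>
      have h1 : 1 + w.length - (1 + (eraseT w).length) = w.length - (eraseT w).length := by omega
      conv_lhs => rw [hw]
      simp [padT, mul_assoc, h1]
    | none =>
      generalize he : eraseT w = v at hw hl
      induction v using FreeMonoid.casesOn with
      | one =>
        simp only [padT, map_one, FreeMonoid.length_one, one_mul] at hw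
        conv_lhs => rw [hw]
        simp [padT, he, pow_add]
      | of_mul x v =>
        refine absurd ?_ (h 1 (FreeMonoid.map some v *
          FreeMonoid.of none ^ (w.length - (FreeMonoid.of x * v).length)) x)
        conv_lhs => rw [hw]
        simp [padT, mul_assoc]

/-! ### Homogenization of multilinear elements -/

theorem wordMon_map (v : FreeMonoid X) : wordMon (FreeMonoid.map some v) =
    (wordMon v).mapDomain fun z => ((some z.1 : Ext X), z.2) := by
  obtain ⟨l, rfl⟩ := FreeMonoid.ofList.surjective v
  induction l using List.reverseRecOn with
  | nil => simp
  | append_singleton l a ih =>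
    rw [FreeMonoid.ofList_append, FreeMonoid.ofList_singleton, map_mul, FreeMonoid.map_of,
      wordMon_mul_of, wordMon_mul_of, Finsupp.mapDomain_add, ih, length_map,
      Finsupp.mapDomain_single]

theorem wordMon_map_mul_pow (v : FreeMonoid X) (k : ℕ) :
    wordMon (FreeMonoid.map some v * FreeMonoid.of none ^ k) =
      (wordMon v).mapDomain (fun z => ((some z.1 : Ext X), z.2)) +
        (oneDeg (v.length + k) - oneDeg v.length).mapDomain fun j => ((none : Ext X), j) := by
  induction k with
  | zero => simp [wordMon_map]
  | succ k ih =>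
    have h1 : oneDeg (v.length + (k + 1)) - oneDeg v.length =
        (oneDeg (v.length + k) - oneDeg v.length) + Finsupp.single (v.length + k) 1 := by
      ext j
      simp only [Finsupp.tsub_apply, Finsupp.add_apply, oneDeg_apply, Finsupp.single_apply]
      split_ifs <;> omega
    rw [pow_succ, ← mul_assoc, wordMon_mul_of, ih, h1, Finsupp.mapDomain_add,
      Finsupp.mapDomain_single, add_assoc]
    simp

theorem wordMon_padT {n : ℕ} {v : FreeMonoid X} (h : v.length ≤ n) : wordMon (padT n v) =
      (wordMon v).mapDomain (fun z => ((some z.1 : Ext X), z.2)) +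
        (oneDeg n - oneDeg v.length).mapDomain fun j => ((none : Ext X), j) := by
  rw [padT, wordMon_map_mul_pow, Nat.add_sub_cancel' h]

theorem lpDehom_monomial (m : (X × ℕ) →₀ ℕ) (n : ℕ →₀ ℕ) (c : K) :
    lpDehom K X (monomial (m.mapDomain (fun z => ((some z.1 : Ext X), z.2)) +
      n.mapDomain fun j => ((none : Ext X), j)) c) = monomial m c := by
  have h1 : ∀ p : LPAlg K X, lpDehom K X (rename (fun z => ((some z.1 : Ext X), z.2)) p) = p := by
    intro p
    rw [lpDehom, aeval_rename]
    exact aeval_X_left_apply p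
  have h2 : lpDehom K X (monomial (n.mapDomain fun j => ((none : Ext X), j)) 1) = 1 := by
    rw [← rename_monomial, lpDehom, aeval_rename, aeval_monomial]
    simp [Finsupp.prod]
  rw [← mul_one c, ← monomial_mul, map_mul, h2, ← rename_monomial, h1, mul_one, mul_one]

/-- The letters `t` have to stand at the end: an inner `t(j)` sent to `1` would leave a gap at place
`j`, whereas erasing a letter of a word moves the later letters to the left. -/
theorem lpDehom_embed {f : FreeAssoc K (Ext X)}
    (hf : ∀ w ∈ f.coeff.support, w = padT w.length (eraseT w)) :
    lpDehom K X (embed K (Ext X) f) = embed K X (dehom K X f) := by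
  rw [dehom_apply, embed_apply, map_sum, map_sum]
  refine Finset.sum_congr rfl fun w hw => ?_
  rw [map_smul, embed_mon, hf w hw, wordMon_padT (length_eraseT_le w), lpDehom_monomial,
    smul_monomial, eraseT_padT, smul_eq_mul, mul_one]

/-- The multidegrees `1^d` form a chain, so their placewise maximum is that of a longest word. -/
theorem topMultideg_embed (f : FreeAssoc K X) :
    topMultideg (embed K X f) = oneDeg (topDegree f) := by
  have hm : Monotone oneDeg := fun a b h k => by
    rw [oneDeg_apply, oneDeg_apply]
    split_ifs <;> omega
  apply le_antisymm
  · refine Finset.sup_le fun m hm' => ?_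
    obtain ⟨v, hv, rfl⟩ := exists_of_mem_support_embed hm'
    rw [multideg_wordMon]
    exact hm (length_le_topDegree hv)
  · rcases f.coeff.support.eq_empty_or_nonempty with h | h
    · simp [topDegree, h, oneDeg]
    · obtain ⟨v, hv, h1⟩ := Finset.exists_mem_eq_sup _ h FreeMonoid.length
      rw [topDegree, h1, ← multideg_wordMon]
      exact Finset.le_sup (wordMon_mem_support_embed.2 hv)

/-- The difference of `1^n` and `1^k` marks exactly the places after a word of length `k` up to
length `n`, so multihomogenization also pads on the right. -/
theorem lpHomogenize_embed (f : FreeAssoc K X) :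
    lpHomogenize (embed K X f) = embed K (Ext X) (homogenize f) := by
  classical
  have hs : (embed K X f).support = f.coeff.support.image wordMon := by
    ext m
    rw [Finset.mem_image]
    constructor
    · intro hm
      obtain ⟨v, hv, rfl⟩ := exists_of_mem_support_embed hm
      exact ⟨v, hv, rfl⟩
    · rintro ⟨v, hv, rfl⟩
      exact wordMon_mem_support_embed.2 hv
  rw [lpHomogenize, hs, Finset.sum_image wordMon_injective.injOn, homogenize_apply, map_sum]
  refine Finset.sum_congr rfl fun v hv => ?_
  rw [map_smul, embed_mon, wordMon_padT (length_le_topDegree hv), topMultideg_embed,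
    multideg_wordMon, coeff_embed, smul_monomial, smul_eq_mul, mul_one]

/-- Erasing `t` is injective on words of one length with all `t` at the end, so setting `t = 1`
merges no terms. -/
theorem coeff_dehom {f : FreeAssoc K (Ext X)} {n : ℕ}
    (hf : ∀ w ∈ f.coeff.support, w = padT n (eraseT w)) (v : FreeMonoid X) :
    (dehom K X f).coeff v = f.coeff (padT n v) := by
  classical
  rw [dehom_apply]
  simp only [mon, MonoidAlgebra.coeff_sum, Finsupp.finsetSum_apply, MonoidAlgebra.coeff_smul,
    MonoidAlgebra.coeff_single, Finsupp.smul_apply, Finsupp.single_apply, smul_eq_mul, mul_ite,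
    mul_one, mul_zero]
  rw [Finset.sum_eq_single (padT n v)]
  · simp
  · intro w hw hne
    rw [if_neg]
    rintro rfl
    exact hne (hf w hw)
  · intro h
    simpa using h

theorem dehom_ne_zero {f : FreeAssoc K (Ext X)} {n : ℕ}
    (hf : ∀ w ∈ f.coeff.support, w = padT n (eraseT w)) (h0 : f ≠ 0) : dehom K X f ≠ 0 := by
  intro h
  apply h0
  ext w
  by_contra hne
  have hw := hf w (Finsupp.mem_support_iff.2 hne)
  apply hne
  rw [hw, ← coeff_dehom hf, h]
  rfl

end Homogenization

/-! ### Correctness of the algorithm -/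

/-! ### Overlaps of words as lcm and gcd of letterplace monomials. -/

section Overlaps

variable {A : Type*}

/-- Both monomials divide that of `u r`. When `d = 1`, every place is covered by `u` or by the
shifted `v`, because `v` starts no later than directly behind `u`. -/
theorem wordMon_sup_shiftMon {u v e r d : FreeMonoid A} (h : u * r = e * v * d)
    (hrd : r = 1 ∨ d = 1) (hl : e.length ≤ u.length) :
    wordMon u ⊔ shiftMon e.length (wordMon v) = wordMon (u * r) := by
  apply le_antisymm
  · refine sup_le ?_ ?_
    · rw [wordMon_mul]
      exact le_self_add
    · rw [h, wordMon_mul_mul]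
      exact le_add_self
  · rcases hrd with rfl | rfl
    · rw [mul_one]
      exact le_sup_left
    · classical
      rintro ⟨a, j⟩
      rw [Finsupp.sup_apply]
      by_cases hj : j < u.length
      · refine le_trans ?_ le_sup_left
        rw [wordMon_mul, Finsupp.add_apply, shiftMon_apply, if_neg hj.not_ge, add_zero]
      · refine le_trans ?_ le_sup_right
        rw [h, mul_one, wordMon_mul, Finsupp.add_apply, wordMon_apply, List.getElem?_eq_none]
        · simp
        · exact hl.trans (not_lt.1 hj)

/-- The first letter of `v`, at place `e.length`, is also a letter of `u`. -/
theorem wordMon_inf_shiftMon_ne_zero {u v e r d : FreeMonoid A} (h : u * r = e * v * d)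
    (hl : e.length < u.length) (hv : v ≠ 1) :
    wordMon u ⊓ shiftMon e.length (wordMon v) ≠ 0 := by
  obtain ⟨s, rfl, hs⟩ := eq_mul_of_mul_eq_mul (a := e) (x := v * d) (c := u) (y := r)
    (by rw [← mul_assoc, h]) hl.le
  induction v using FreeMonoid.casesOn with
  | one => exact absurd rfl hv
  | of_mul x v =>
    induction s using FreeMonoid.casesOn with
    | one => simp at hl
    | of_mul y s =>
      have hxy : x = y := by
        have := congrArg FreeMonoid.toList hs
        simp only [FreeMonoid.toList_mul, FreeMonoid.toList_of,
          List.cons_append, List.cons.injEq] at this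
        exact this.1
      subst hxy
      intro h0
      have h1 := DFunLike.congr_fun h0 (x, e.length)
      rw [Finsupp.inf_apply, wordMon_mul, wordMon_of_mul, wordMon_of_mul, map_add, map_add,
        shiftMon_single] at h1
      simp at h1

end Overlaps

/-! ### Reductions of the algorithm, seen after setting `t = 1`. -/

section Algorithm

variable {K X : Type*} [Field K] {ord : MonomialOrder (Ext X)} {I : TwoSidedIdeal (FreeAssoc K X)}
  {G : Set (LPAlg K (Ext X))}

/-- The nonzero polynomials whose homogenizations occur in `G`. -/
def dehomSet (G : Set (LPAlg K (Ext X))) : Set (FreeAssoc K X) :=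
  {p | p ≠ 0 ∧ embed K (Ext X) (homogenize p) ∈ G}

/-- `G` consists of the commutators `[t, x]` and of homogenizations of elements of `I`. -/
structure IsAdapted (I : TwoSidedIdeal (FreeAssoc K X)) (G : Set (LPAlg K (Ext X))) : Prop where
  commutator_mem : ∀ x : X, embed K (Ext X) (tVar K X * xVar K x - xVar K x * tVar K X) ∈ G
  eq_or_eq : ∀ g ∈ G, (∃ p ∈ I, p ≠ 0 ∧ g = embed K (Ext X) (homogenize p)) ∨
    ∃ x : X, g = embed K (Ext X) (tVar K X * xVar K x - xVar K x * tVar K X)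

/-- The span of the dehomogenizations of the multiples of homogenizations of elements of `H` whose
leading words are smaller than `W` and of the same length. -/
noncomputable def dehomBelow (ord : MonomialOrder (Ext X)) (H : Set (FreeAssoc K X))
    (W : FreeMonoid (Ext X)) : Submodule K (FreeAssoc K X) :=
  Submodule.span K {x | ∃ p ∈ H, ∃ w a b, IsLead (extKey ord) p w ∧
    (a * FreeMonoid.map some w * b).length = W.length ∧
    wordKey ord (a * FreeMonoid.map some w * b) < wordKey ord W ∧
    x = mon K (eraseT a) * p * mon K (eraseT b)}

theorem dehomBelow_mono {H H' : Set (FreeAssoc K X)} (h : H ⊆ H') (W : FreeMonoid (Ext X)) :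
    dehomBelow ord H W ≤ dehomBelow ord H' W := by
  apply Submodule.span_mono
  rintro x ⟨p, hp, hx⟩
  exact ⟨p, h hp, hx⟩

theorem smul_mem_ideal (c : K) {f : FreeAssoc K X} (hf : f ∈ I) : c • f ∈ I := by
  rw [← one_mul f, ← smul_mul_assoc]
  exact I.mul_mem_left _ _ hf

theorem mem_ideal_of_mem_dehomBelow {H : Set (FreeAssoc K X)} (hH : ∀ p ∈ H, p ∈ I)
    {W : FreeMonoid (Ext X)} {f : FreeAssoc K X} (hf : f ∈ dehomBelow ord H W) : f ∈ I := by
  induction hf using Submodule.span_induction with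
  | mem x hx =>
    obtain ⟨p, hp, w, a, b, -, -, -, rfl⟩ := hx
    exact I.mul_mem_right _ _ (I.mul_mem_left _ _ (hH p hp))
  | zero => exact I.zero_mem
  | add x y _ _ hx hy => exact I.add_mem hx hy
  | smul c x _ hx => exact smul_mem_ideal c hx

/-- The bound contains no `t`, so `extKey_eraseT_lt` keeps the inequality when `t` is erased from
the multiples. This carries representations over to the algebra over `X`. -/
theorem dehomBelow_le_below (H : Set (FreeAssoc K X)) (v : FreeMonoid X) :
    dehomBelow ord H (FreeMonoid.map some v) ≤
      below (extKey ord) H fun w => extKey ord w < extKey ord v := by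
  apply Submodule.span_le.2
  rintro x ⟨p, hp, w, a, b, hw, hl, hlt, rfl⟩
  refine mul_mem_below hp hw ?_
  have := extKey_eraseT_lt ord (v := v) (by simpa using hl) hlt
  simpa using this

/-- A homogenization of a nonzero `p` is not a commutator, since commutators become zero at `t = 1`.
-/
theorem IsAdapted.mem_of_mem_dehomSet (hG : IsAdapted I G) {p : FreeAssoc K X}
    (hp : p ∈ dehomSet G) : p ∈ I := by
  rcases hG.eq_or_eq _ hp.2 with ⟨q, hq, -, h⟩ | ⟨x, h⟩
  · have := congrArg (dehom K X) (embed_injective h)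
    rw [dehom_homogenize, dehom_homogenize] at this
    rwa [this]
  · have := congrArg (dehom K X) (embed_injective h)
    rw [dehom_homogenize, dehom_commutator] at this
    exact absurd this hp.1

theorem IsAdapted.exists_isLead
    (ht : ∀ x : X, ord.toSyn (Finsupp.single none 1) < ord.toSyn (Finsupp.single (some x) 1))
    (hG : IsAdapted I G) {g : LPAlg K (Ext X)} (hg : g ∈ G) :
    ∃ f w, IsHomog f w.length ∧ IsLead (wordKey ord) f w ∧ g = embed K (Ext X) f := by
  rcases hG.eq_or_eq g hg with ⟨p, -, hp, rfl⟩ | ⟨x, rfl⟩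
  · obtain ⟨w, hw⟩ := Letterplace.exists_isLead (extKey_injective ord) hp
    refine ⟨_, FreeMonoid.map some w, ?_, hw.homogenize ht, rfl⟩
    rw [length_map, hw.length_eq_topDegree]
    exact isHomog_homogenize p
  · exact ⟨_, _, isHomog_commutator x, isLead_commutator ht x, rfl⟩

theorem IsAdapted.dehom_mem (hG : IsAdapted I G) {f : FreeAssoc K (Ext X)}
    (hf : embed K (Ext X) f ∈ G) : dehom K X f ∈ I := by
  rcases hG.eq_or_eq _ hf with ⟨p, hp, -, h⟩ | ⟨x, h⟩
  · rwa [embed_injective h, dehom_homogenize]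
  · rw [embed_injective h, dehom_commutator]
    exact I.zero_mem

theorem IsAdapted.dehom_mul_mem_dehomBelow
    (ht : ∀ x : X, ord.toSyn (Finsupp.single none 1) < ord.toSyn (Finsupp.single (some x) 1))
    (hG : IsAdapted I G) {f : FreeAssoc K (Ext X)}
    (hf : embed K (Ext X) f ∈ G) {w a b W : FreeMonoid (Ext X)} (hw : IsLead (wordKey ord) f w)
    (hl : (a * w * b).length = W.length) (hlt : wordKey ord (a * w * b) < wordKey ord W) :
    dehom K X (mon K a * f * mon K b) ∈ dehomBelow ord (dehomSet G) W := by
  rw [map_mul, map_mul, dehom_mon, dehom_mon]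
  rcases hG.eq_or_eq _ hf with ⟨p, hp, hp0, h⟩ | ⟨x, h⟩
  · obtain ⟨v, hv⟩ := Letterplace.exists_isLead (extKey_injective ord) hp0
    have hfp := embed_injective h
    subst hfp
    rw [hw.unique (hv.homogenize ht)] at hl hlt
    rw [dehom_homogenize]
    exact Submodule.subset_span ⟨p, ⟨hp0, hf⟩, v, a, b, hv, hl, hlt, rfl⟩
  · rw [embed_injective h, dehom_commutator, mul_zero, zero_mul]
    exact zero_mem _

/-- `f` is homogeneous of the degree of `W`, with all words smaller than `W`. -/
def IsBelow (ord : MonomialOrder (Ext X)) (f : FreeAssoc K (Ext X)) (W : FreeMonoid (Ext X)) :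
    Prop :=
  IsHomog f W.length ∧ ∀ w ∈ f.coeff.support, wordKey ord w < wordKey ord W

/-- Each step subtracts a homogeneous multiple whose leading word occurs in the current polynomial,
hence has the length of `W` and lies below `W`. The subtracted multiples, dehomogenized, add up to
the difference. -/
theorem IsAdapted.exists_of_reflTransGen
    (ht : ∀ x : X, ord.toSyn (Finsupp.single none 1) < ord.toSyn (Finsupp.single (some x) 1))
    (hG : IsAdapted I G) {f : FreeAssoc K (Ext X)}
    {W : FreeMonoid (Ext X)} (hf : IsBelow ord f W) {q : LPAlg K (Ext X)}
    (h : Relation.ReflTransGen (ReduceStep (placeOrder ord) (shifts G)) (embed K (Ext X) f) q) :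
    ∃ f', q = embed K (Ext X) f' ∧ IsBelow ord f' W ∧
      dehom K X f - dehom K X f' ∈ dehomBelow ord (dehomSet G) W := by
  induction h with
  | refl => exact ⟨f, rfl, hf, by simp⟩
  | tail _ hs ih =>
    obtain ⟨f', rfl, ⟨hf1, hf2⟩, hd⟩ := ih
    obtain ⟨g, w, a, b, c, hgG, hg, hw, hz, rfl⟩ :=
      hs.exists_eq_embed ord fun p hp => hG.exists_isLead ht hp
    have hl := hf1 _ hz
    have hlt := hf2 _ hz
    refine ⟨_, rfl, ⟨fun v hv => ?_, fun v hv => ?_⟩, ?_⟩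
    · rcases mem_support_sub hv with h | h
      · exact hf1 v h
      · rw [(hg.mon_mul_mul_mon a b) v (mem_support_smul h), ← hl]
        simp
    · rcases mem_support_sub hv with h | h
      · exact hf2 v h
      · by_cases e : v = a * w * b
        · rwa [e]
        · exact ((hw.mul (wordKey_mul_lt ord) a b).2 v (mem_support_smul h) e).trans hlt
    · have := Submodule.smul_mem _ c (hG.dehom_mul_mem_dehomBelow ht hgG hw hl hlt)
      convert add_mem hd this using 1
      rw [map_sub, map_smul]
      abel

/-- The effect of one reduction in the inner loop. -/
theorem IsAdapted.update
    (ht : ∀ x : X, ord.toSyn (Finsupp.single none 1) < ord.toSyn (Finsupp.single (some x) 1))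
    (hG : IsAdapted I G) {f : FreeAssoc K (Ext X)}
    {W : FreeMonoid (Ext X)} (hf : IsBelow ord f W) (hI : dehom K X f ∈ I)
    {h : LPAlg K (Ext X)}
    (hr : IsReduct (placeOrder ord) (shifts G) (embed K (Ext X) f) h) {s s' : State K X}
    (hs : s.G = G) (hu : Update s h s') :
    IsAdapted I s'.G ∧ dehom K X f ∈ dehomBelow ord (dehomSet s'.G) W := by
  subst hs
  obtain ⟨q, rfl, ⟨hq1, hq2⟩, hd⟩ := hG.exists_of_reflTransGen ht hf hr.1
  -- The leading words `t x` of the commutators do not divide a word of a normal form.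
  have hnorm : ∀ w ∈ q.coeff.support, w = padT w.length (eraseT w) := fun w hw =>
    eq_padT_eraseT fun a b x => hr.2.ne_mul ord (hG.commutator_mem x) (isLead_commutator ht x) hw
      a b
  have hnorm' : ∀ w ∈ q.coeff.support, w = padT W.length (eraseT w) := fun w hw => by
    rw [← hq1 w hw]
    exact hnorm w hw
  generalize hh : embed K (Ext X) q = h at hu
  cases hu with
  | zero =>
    have hq0 : q = 0 := embed_injective (hh.trans (map_zero _).symm)
    rw [hq0, map_zero, sub_zero] at hd
    exact ⟨hG, hd⟩
  | new _ h' hne hh' =>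
    subst hh
    rw [lpDehom_embed hnorm, lpHomogenize_embed] at hh'
    have hq0 : q ≠ 0 := by
      rintro rfl
      exact hne (map_zero _)
    have hp0 : dehom K X q ≠ 0 := dehom_ne_zero hnorm' hq0
    have hpI : dehom K X q ∈ I := by
      have := I.sub_mem hI (mem_ideal_of_mem_dehomBelow (fun p => hG.mem_of_mem_dehomSet) hd)
      simpa using this
    refine ⟨⟨fun x => Or.inl (hG.commutator_mem x), ?_⟩, ?_⟩
    · rintro g (hg | rfl)
      · exact hG.eq_or_eq g hg
      · exact Or.inl ⟨_, hpI, hp0, hh'⟩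
    · have h1 := dehomBelow_mono (ord := ord) (H' := dehomSet (s.G ∪ {h'}))
        (fun p hp => ⟨hp.1, Or.inl hp.2⟩) W hd
      obtain ⟨v, hv⟩ := Letterplace.exists_isLead (extKey_injective ord) hp0
      have hvq : padT W.length v ∈ q.coeff.support := by
        rw [Finsupp.mem_support_iff, ← coeff_dehom hnorm']
        exact hv.coeff_ne_zero
      -- The multiplier is the power of `t` that pads `v` to the length of `W`. The padded word
      -- occurs in `q`, hence lies below `W`, and the power of `t` disappears at `t = 1`.
      have h2 : dehom K X q ∈ dehomBelow ord (dehomSet (s.G ∪ {h'})) W := by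
        refine Submodule.subset_span ⟨_, ⟨hp0, Or.inr hh'.symm⟩, v, 1,
          FreeMonoid.of none ^ (W.length - v.length), hv, ?_, ?_, ?_⟩
        · simpa [padT] using hq1 _ hvq
        · simpa [padT] using hq2 _ hvq
        · simp
      simpa using add_mem h1 h2

theorem isBelow_spoly {f g : FreeAssoc K (Ext X)} {u v e r d : FreeMonoid (Ext X)}
    (hf : IsHomog f u.length) (hg : IsHomog g v.length) (hu : IsLead (wordKey ord) f u)
    (hv : IsLead (wordKey ord) g v) (h : u * r = e * v * d) :
    IsBelow ord ((f.coeff u)⁻¹ • (f * mon K r) - (g.coeff v)⁻¹ • (mon K e * g * mon K d))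
      (u * r) := by
  have hu' := hu.mul (wordKey_mul_lt ord) 1 r
  have hv' := hv.mul (wordKey_mul_lt ord) e d
  have hf' := hf.mon_mul_mul_mon 1 r
  have hg' := hg.mon_mul_mul_mon e d
  have hcf := coeff_mon_mul_mul_mon (K := K) 1 r f u
  have hcg := coeff_mon_mul_mul_mon (K := K) e d g v
  rw [mon_one, one_mul, one_mul] at hu' hcf
  rw [mon_one, one_mul] at hf'
  rw [← h] at hv' hcg
  refine ⟨fun w hw => ?_, fun w hw => ?_⟩
  · rcases mem_support_sub hw with h1 | h1
    · rw [hf' w (mem_support_smul h1)]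
      simp
    · rw [hg' w (mem_support_smul h1), h]
      simp
  -- Both multiples are monic at `u r`, so this word cancels.
  · have hne : w ≠ u * r := by
      rintro rfl
      simp [hcf, hcg, hu.coeff_ne_zero, hv.coeff_ne_zero] at hw
    rcases mem_support_sub hw with h1 | h1
    · exact hu'.2 w (mem_support_smul h1) hne
    · exact hv'.2 w (mem_support_smul h1) hne

theorem IsAdapted.dehom_spoly_mem (hG : IsAdapted I G) {f g : FreeAssoc K (Ext X)}
    (hf : embed K (Ext X) f ∈ G) (hg : embed K (Ext X) g ∈ G) (c c' : K)
    (r e d : FreeMonoid (Ext X)) :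
    dehom K X (c • (f * mon K r) - c' • (mon K e * g * mon K d)) ∈ I := by
  rw [map_sub, map_smul, map_smul, map_mul, map_mul, map_mul]
  exact I.sub_mem (smul_mem_ideal _ (I.mul_mem_right _ _ (hG.dehom_mem hf)))
    (smul_mem_ideal _ (I.mul_mem_right _ _ (I.mul_mem_left _ _ (hG.dehom_mem hg))))

/-- A multilinear lcm is the monomial of a word; the unshifted `u` is a prefix of it and `v` a
factor. -/
theorem Admissible.exists_mul_eq_mul {f g : FreeAssoc K (Ext X)} {u v : FreeMonoid (Ext X)} {i : ℕ}
    (h : Admissible ord (embed K (Ext X) f) (embed K (Ext X) g) i)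
    (hu : IsLead (wordKey ord) f u) (hv : IsLead (wordKey ord) g v) :
    ∃ e r d, u * r = e * v * d ∧ (e.length = i ∨ v = 1) ∧
      wordMon u ⊔ shiftMon i (wordMon v) = wordMon (u * r) := by
  obtain ⟨h1, n, h2⟩ := h
  rw [degree_shift_embed ord i hv, degree_embed ord hu] at h1 h2
  obtain ⟨W, -, hW⟩ := exists_wordMon_eq_of_multideg_eq
    (h2 (wordMon u ⊔ shiftMon i (wordMon v)) (by
      classical
      rw [MvPolynomial.mem_support_iff, coeff_monomial, if_pos rfl]
      exact one_ne_zero))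
  obtain ⟨a, r, rfl, ha⟩ := exists_eq_mul_of_shiftMon_le (i := 0) (v := u) (w := W)
    (by rw [shiftMon_zero_left, ← hW]; exact le_sup_left)
  -- The case `u = 1` is excluded by the condition on the gcd.
  have ha1 : a = 1 := by
    rcases ha with ha | rfl
    · exact FreeMonoid.length_eq_zero.1 ha
    · refine absurd ?_ h1
      rw [wordMon_one]
      exact inf_eq_left.2 zero_le
  subst ha1
  rw [one_mul] at hW
  obtain ⟨e, d, he, hi⟩ := exists_eq_mul_of_shiftMon_le (i := i) (v := v) (w := u * r)
    (by rw [← hW]; exact le_sup_right)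
  exact ⟨e, r, d, he, hi, hW⟩

/-! ### Processed pairs and the loop invariant. -/

/-- The S-polynomial of the dehomogenizations of `f` and `i · g` has a representation with leading
words smaller than the overlap. -/
def Processed (ord : MonomialOrder (Ext X)) (G : Set (LPAlg K (Ext X))) (f g : LPAlg K (Ext X))
    (i : ℕ) : Prop :=
  ∀ p q u v, f = embed K (Ext X) (homogenize p) → g = embed K (Ext X) (homogenize q) →
    IsLead (extKey ord) p u → IsLead (extKey ord) q v → ∀ e r d, e.length = i →
    u * r = e * v * d → (r = 1 ∨ d = 1) → e.length ≤ u.length →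
    (p.coeff u)⁻¹ • (p * mon K r) - (q.coeff v)⁻¹ • (mon K e * q * mon K d) ∈
      below (extKey ord) (dehomSet G) fun w => extKey ord w < extKey ord (u * r)

theorem Processed.mono {G' : Set (LPAlg K (Ext X))} (hGG : G ⊆ G') {f g : LPAlg K (Ext X)} {i : ℕ}
    (h : Processed ord G f g i) : Processed ord G' f g i :=
  fun p q u v hf hg hu hv e r d hi heq hrd hl =>
    below_mono (show dehomSet G ⊆ dehomSet G' from fun _ hp => ⟨hp.1, hGG hp.2⟩) (fun _ hw => hw)
      (h p q u v hf hg hu hv e r d hi heq hrd hl)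

/-- One passage through the body of the inner loop. -/
theorem IsAdapted.processed
    (ht : ∀ x : X, ord.toSyn (Finsupp.single none 1) < ord.toSyn (Finsupp.single (some x) 1))
    {s s' : State K X} (hG : IsAdapted I s.G) {f g h : LPAlg K (Ext X)}
    (hf : f ∈ s.G) (hg : g ∈ s.G) {i : ℕ} (hi : Admissible ord f g i)
    (hr : IsReduct (placeOrder ord) (shifts s.G) (spoly (placeOrder ord) f (shift i g)) h)
    (hu : Update s h s') : IsAdapted I s'.G ∧ Processed ord s'.G f g i := by
  constructor
  · obtain ⟨p, u, hp, hpu, rfl⟩ := hG.exists_isLead ht hf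
    obtain ⟨q, v, hq, hqv, rfl⟩ := hG.exists_isLead ht hg
    obtain ⟨e, r, d, heq, hei, hsup⟩ := hi.exists_mul_eq_mul hpu hqv
    rw [spoly_embed ord hp hq hpu hqv heq hei hsup] at hr
    exact (hG.update ht (isBelow_spoly hp hq hpu hqv heq) (hG.dehom_spoly_mem hf hg _ _ _ _ _)
      hr rfl hu).1
  -- For two homogenizations the overlap word is free of `t`, and setting `t = 1` turns the
  -- letterplace S-polynomial into that of `p` and `q`.
  · rintro p q u v rfl rfl hpu hqv e r d rfl heq hrd hl
    have hpu' := hpu.homogenize ht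
    have hqv' := hqv.homogenize ht
    have hp := isHomog_homogenize p
    have hq := isHomog_homogenize q
    rw [← hpu.length_eq_topDegree, ← length_map some] at hp
    rw [← hqv.length_eq_topDegree, ← length_map some] at hq
    have heq' : FreeMonoid.map some u * FreeMonoid.map some r =
        FreeMonoid.map some e * FreeMonoid.map some v * FreeMonoid.map some d := by
      simp only [← map_mul, heq]
    have hsup := wordMon_sup_shiftMon heq'
      (hrd.imp (fun h => by rw [h, map_one]) fun h => by rw [h, map_one]) (by simpa using hl)
    rw [length_map] at hsup
    rw [spoly_embed ord hp hq hpu' hqv' heq' (Or.inl (length_map _ _)) hsup] at hr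
    have := (hG.update ht (isBelow_spoly hp hq hpu' hqv' heq')
      (hG.dehom_spoly_mem hf hg _ _ _ _ _) hr rfl hu).2
    rw [← map_mul] at this
    have := dehomBelow_le_below _ _ this
    simpa [dehom_mon, dehom_homogenize, coeff_homogenize_lead hpu, coeff_homogenize_lead hqv]
      using this

theorem Update.subset {s s' : State K X} {h : LPAlg K (Ext X)} (hu : Update s h s') :
    s.G ⊆ s'.G ∧ s.B ⊆ s'.B := by
  cases hu with
  | zero => exact ⟨subset_rfl, subset_rfl⟩
  | new => exact ⟨Set.subset_union_left, Set.subset_union_left⟩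

theorem Update.mem_of_mem_B {s s' : State K X} {h : LPAlg K (Ext X)} (hu : Update s h s')
    (hB : s.B ⊆ s.G ×ˢ s.G) : s'.B ⊆ s'.G ×ˢ s'.G := by
  cases hu with
  | zero => exact hB
  | new h h' =>
    rintro p (hp | rfl | ⟨k, hk, rfl | rfl⟩)
    · exact ⟨Or.inl (hB hp).1, Or.inl (hB hp).2⟩
    · exact ⟨Or.inr rfl, Or.inr rfl⟩
    · exact ⟨Or.inr rfl, Or.inl hk⟩
    · exact ⟨Or.inl hk, Or.inr rfl⟩

theorem Update.mem_B_or {s s' : State K X} {h : LPAlg K (Ext X)} (hu : Update s h s')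
    {a b : LPAlg K (Ext X)} (ha : a ∈ s'.G) (hb : b ∈ s'.G) :
    (a, b) ∈ s'.B ∨ a ∈ s.G ∧ b ∈ s.G := by
  cases hu with
  | zero => exact Or.inr ⟨ha, hb⟩
  | new h h' =>
    rcases ha with ha | rfl <;> rcases hb with hb | rfl
    · exact Or.inr ⟨ha, hb⟩
    · exact Or.inl (Or.inr (Or.inr ⟨a, ha, Or.inr rfl⟩))
    · exact Or.inl (Or.inr (Or.inr ⟨b, hb, Or.inl rfl⟩))
    · exact Or.inl (Or.inr (Or.inl rfl))

/-- The basis only grows, so shifts already treated stay processed. By the last clause, a pair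
missing from `B` afterwards consists of elements present before the loop. -/
theorem InnerLoop.correct
    (ht : ∀ x : X, ord.toSyn (Finsupp.single none 1) < ord.toSyn (Finsupp.single (some x) 1))
    {f g : LPAlg K (Ext X)} {l : List ℕ} {s s' : State K X}
    (h : InnerLoop ord f g l s s') (hG : IsAdapted I s.G) (hf : f ∈ s.G) (hg : g ∈ s.G)
    (hB : s.B ⊆ s.G ×ˢ s.G) (hl : ∀ i ∈ l, Admissible ord f g i) :
    IsAdapted I s'.G ∧ s'.B ⊆ s'.G ×ˢ s'.G ∧ s.G ⊆ s'.G ∧ s.B ⊆ s'.B ∧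
      (∀ i ∈ l, Processed ord s'.G f g i) ∧
      ∀ a ∈ s'.G, ∀ b ∈ s'.G, (a, b) ∈ s'.B ∨ a ∈ s.G ∧ b ∈ s.G := by
  induction h with
  | nil s =>
    exact ⟨hG, hB, subset_rfl, subset_rfl, by simp, fun a ha b hb => Or.inr ⟨ha, hb⟩⟩
  | cons i l s s' s'' h hred hupd _ ih =>
    obtain ⟨h1, h2⟩ := hG.processed ht hf hg (hl i List.mem_cons_self) hred hupd
    obtain ⟨hGs, hBs⟩ := hupd.subset
    obtain ⟨k1, k2, k3, k4, k5, k6⟩ := ih h1 (hGs hf) (hGs hg) (hupd.mem_of_mem_B hB)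
      fun j hj => hl j (List.mem_cons_of_mem _ hj)
    refine ⟨k1, k2, hGs.trans k3, hBs.trans k4, ?_, fun a ha b hb => ?_⟩
    · intro j hj
      rcases List.mem_cons.1 hj with rfl | hj
      · exact h2.mono k3
      · exact k5 j hj
    · rcases k6 a ha b hb with h | ⟨ha, hb⟩
      · exact Or.inl h
      · exact (hupd.mem_B_or ha hb).imp_left fun h => k4 h

/-- The invariant of the while loop. -/
structure LoopInvariant (ord : MonomialOrder (Ext X)) (H : Set (FreeAssoc K X))
    (I : TwoSidedIdeal (FreeAssoc K X)) (s : State K X) : Prop where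
  adapted : IsAdapted I s.G
  input_mem : ∀ p ∈ H, p ≠ 0 → p ∈ dehomSet s.G
  pairs_subset : s.B ⊆ s.G ×ˢ s.G
  processed : ∀ f ∈ s.G, ∀ g ∈ s.G, (f, g) ∈ s.B ∨
    ∀ i, Admissible ord f g i → Processed ord s.G f g i

theorem loopInvariant_initial {H : Set (FreeAssoc K X)} (hH : ∀ p ∈ H, p ∈ I) :
    LoopInvariant ord H I (initial H) where
  adapted := by
    constructor
    · exact fun x => ⟨_, Or.inr ⟨x, rfl⟩, rfl⟩
    · rintro _ ⟨_, ⟨p, hp, hp0, rfl⟩ | ⟨x, rfl⟩, rfl⟩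
      · exact Or.inl ⟨p, hH p hp, hp0, rfl⟩
      · exact Or.inr ⟨x, rfl⟩
  input_mem := fun p hp hp0 => ⟨hp0, _, Or.inl ⟨p, hp, hp0, rfl⟩, rfl⟩
  pairs_subset := subset_rfl
  processed := fun _ hf _ hg => Or.inl ⟨hf, hg⟩

theorem LoopInvariant.step
    (ht : ∀ x : X, ord.toSyn (Finsupp.single none 1) < ord.toSyn (Finsupp.single (some x) 1))
    {H : Set (FreeAssoc K X)} {s s' : State K X}
    (hs : LoopInvariant ord H I s) (h : Step ord s s') : LoopInvariant ord H I s' := by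
  obtain ⟨f, g, hfg, l, -, hl, hloop⟩ := h
  obtain ⟨hf, hg⟩ := hs.pairs_subset hfg
  obtain ⟨k1, k2, k3, k4, k5, k6⟩ := hloop.correct ht hs.adapted hf hg
    (Set.sdiff_subset.trans hs.pairs_subset) fun i hi => (hl i).1 hi
  refine ⟨k1, fun p hp hp0 => ⟨hp0, k3 (hs.input_mem p hp hp0).2⟩, k2, fun a ha b hb => ?_⟩
  rcases k6 a ha b hb with h | ⟨ha, hb⟩
  · exact Or.inl h
  -- The pair taken out of `B` has just had all its admissible shifts treated; every other old pair
  -- keeps its status.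
  by_cases hab : (a, b) = (f, g)
  · obtain ⟨rfl, rfl⟩ := Prod.mk.inj hab
    exact Or.inr fun i hi => k5 i ((hl i).2 hi)
  · exact (hs.processed a ha b hb).imp (fun h => k4 ⟨h, hab⟩) fun h i hi => (h i hi).mono k3

/-- For a genuine overlap the shift `e.length` is admissible: the lcm is the monomial of the overlap
word, and the gcd is nontrivial because `v` starts inside `u`. As no pair is waiting, this shift has
been processed. -/
theorem LoopInvariant.overlapsResolve
    (ht : ∀ x : X, ord.toSyn (Finsupp.single none 1) < ord.toSyn (Finsupp.single (some x) 1))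
    {H : Set (FreeAssoc K X)} {s : State K X}
    (hs : LoopInvariant ord H I s) (hB : s.B = ∅) :
    OverlapsResolve (extKey ord) (dehomSet s.G) := by
  intro p hp q hq u v hu hv e r d heq hrd hl hv1
  rcases hs.processed _ hp.2 _ hq.2 with h | h
  · simp [hB] at h
  refine h e.length ?_ p q u v rfl rfl hu hv e r d rfl heq hrd hl.le
  have heq' : FreeMonoid.map some u * FreeMonoid.map some r =
      FreeMonoid.map some e * FreeMonoid.map some v * FreeMonoid.map some d := by
    simp only [← map_mul, heq]
  have hsup := wordMon_sup_shiftMon heq'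
    (hrd.imp (fun h => by rw [h, map_one]) fun h => by rw [h, map_one]) (by simpa using hl.le)
  have hinf := wordMon_inf_shiftMon_ne_zero heq' (by simpa using hl) fun h =>
    hv1 (map_some_injective (h.trans (map_one _).symm))
  rw [length_map] at hsup hinf
  constructor
  · rwa [degree_embed ord (hu.homogenize ht), degree_shift_embed ord _ (hv.homogenize ht)]
  · rw [degree_embed ord (hu.homogenize ht), degree_shift_embed ord _ (hv.homogenize ht), hsup]
    refine ⟨(FreeMonoid.map some u * FreeMonoid.map some r).length, fun m hm => ?_⟩
    rw [Finset.mem_singleton.1 (support_monomial_subset hm), multideg_wordMon]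

end Algorithm

end Letterplace

theorem mainTheorem2 {K X : Type*} [Field K] [Countable X] [LinearOrder X]
    (ord : MonomialOrder (Letterplace.Ext X))
    (ht : ∀ x : X, ord.toSyn (Finsupp.single none 1) < ord.toSyn (Finsupp.single (some x) 1))
    (hx : ∀ x y : X, x < y →
      ord.toSyn (Finsupp.single (some x) 1) < ord.toSyn (Finsupp.single (some y) 1))
    (I : TwoSidedIdeal (Letterplace.FreeAssoc K X)) (H : Set (Letterplace.FreeAssoc K X))
    (hH : TwoSidedIdeal.span H = I)
    (R : Set (Letterplace.FreeAssoc K X)) (hR : Letterplace.FreeGBasisReturns ord H R) :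
    Letterplace.IsGroebnerBasis ord R I := by
  obtain ⟨s, hs, hB, rfl⟩ := hR
  have inv : Letterplace.LoopInvariant ord H I s := by
    clear hB
    induction hs with
    | refl =>
      exact Letterplace.loopInvariant_initial fun p hp => hH ▸ TwoSidedIdeal.subset_span hp
    | tail _ h ih => exact ih.step ht h
  refine ⟨?_, fun f hf hf0 => ?_⟩
  · rintro _ ⟨p, hp, rfl⟩
    exact inv.adapted.dehom_mem hp
  · rw [← hH] at hf
    obtain ⟨w, hw, p, hp, w', hw', u, v, h⟩ := (inv.overlapsResolve ht hB).exists_isLead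
      (Letterplace.extKey_injective ord) (Letterplace.extKey_one_le ord)
      (Letterplace.extKey_mul_lt ord)
      (Letterplace.span_le_below (Letterplace.extKey_injective ord) inv.input_mem hf) hf0
    -- The divisor `p` belongs to the output because it is `φ(p^*)` with the image of `p^*` in `G`.
    exact ⟨w, hw, p, ⟨_, hp.2, Letterplace.dehom_homogenize p⟩, hp.1, w', hw', u, v, h⟩
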